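/- Let $k$ be a field and let $\Gamma=(V,E)$ be a directed graph (multiple edges allowed) with finitely many vertices, with tail and head maps $t,h:E\to V$, which is layered: $V=\bigsqcup_{i\ge 0}V_i$, every edge $e$ goes from some $V_i$ to $V_{i-1}$, $V_0=\{*\}$, and every $v\neq *$ is the tail of at least one edge. Write $|v|=i$ for $v\in V_i$ and $|e|=|t(e)|$, and write $v>w$ if there is a path (of positive length) from $v$ to $w$. For a path $\pi=(e_1,\dots,e_m)$ put $e(\pi,j)=\sum_{1\le i_1<\dots<i_j\le m}e_{i_1}\cdots e_{i_j}$ in the free algebra $T(E)$ over $k$. Let $A(\Gamma)=T(E)/R$, where $R$ is the two-sided ideal generated by all $e(\pi_1,j)-e(\pi_2,j)$ with $\pi_1,\pi_2$ paths having the same tail and the same head and $1\le j\le$ their length. Let $A(\Gamma)_{[d]}$ be the span of the words of length $d$ in the edges, and $A(\Gamma)_{(i)}$ the span of the words $e_1\cdots e_r$ with $|e_1|+\dots+|e_r|\le i$. Let $\mathrm{gr}A(\Gamma)=\bigoplus_i A(\Gamma)_{(i)}/A(\Gamma)_{(i-1)}$ be the associated graded algebra, and let $(\mathrm{gr}A(\Gamma))_{[d]}$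 be its subspace spanned by the classes in $A(\Gamma)_{(i)}/A(\Gamma)_{(i-1)}$ of the elements of $A(\Gamma)_{[d]}\cap A(\Gamma)_{(i)}$, $i\ge 0$. For every $v\ne *$ fix an edge $e_v$ with tail $v$. Let $\pi_v=(e_1,\dots,e_{|v|})$ be the path from $v$ to $*$ formed by these edges, and for $1\le j\le|v|$ let $e(v,j)\in \mathrm{gr}A(\Gamma)$ be the class of $e_1\cdots e_j$ (in filtration degree $|e_1|+\dots+|e_j|$). Let $\sigma$ be a level-preserving automorphism of $\Gamma$, acting on $A(\Gamma)$ and on $\mathrm{gr}A(\Gamma)$ by $e\mapsto\sigma(e)$, let $V_\sigma$ be the set of vertices fixed by $\sigma$, and let $A(\Gamma^\sigma)\subseteq \mathrm{gr}A(\Gamma)$ be the span of all products $e(v_1,j_1)\cdots e(v_l,j_l)$ with $l\ge 0$, $v_i\in V_\sigma\setminus\{*\}$, $1\le j_i\le|v_i|$, such that for no $i<l$ both $v_i>v_{i+1}$ and $j_i=|v_i|-|v_{i+1}|$ hold. Then $A(\Gamma^\sigma)$ is a subalgebra of $\mathrm{gr}A(\Gamma)$, and all the spaces $A(\Gamma)_{[d]}$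 and $(\mathrm{gr}A(\Gamma))_{[d]}$ are finite-dimensional. Let $H(t)=\sum_d \dim\bigl(A(\Gamma^\sigma)\cap(\mathrm{gr}A(\Gamma))_{[d]}\bigr)t^d\in\mathbb Z[[t]]$ be the Hilbert series of $A(\Gamma^\sigma)$. The graded traces $\sum_d \mathrm{tr}\bigl(\sigma|_{(\mathrm{gr}A(\Gamma))_{[d]}}\bigr)t^d$ and $\sum_d \mathrm{tr}\bigl(\sigma|_{A(\Gamma)_{[d]}}\bigr)t^d$ in $k[[t]]$ are both equal to the image of $H(t)$ in $k[[t]]$, and in $\mathbb Z[[t]]$ $$H(t)=\frac{1-t}{1-t\displaystyle\sum_{v_1>\cdots>v_l\ge *}(-1)^{l-1}t^{|v_1|-|v_l|}},$$ where the sum is over all chains $v_1>\dots>v_l$, $l\ge1$, of vertices in $V_\sigma$ (the vertex $*$ is allowed), and the denominator is invertible in $\mathbb Z[[t]]$. -/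

import Mathlib

/-! ## Filtered algebras and their associated graded algebras -/

/-- An increasing, multiplicative filtration of a `k`-algebra by submodules, indexed by `ℕ`. -/
structure AlgFiltration (k A : Type*) [Field k] [Ring A] [Algebra k A] where
  /-- the `i`-th piece `A_(i)` -/
  piece : ℕ → Submodule k A
  mono : Monotone piece
  algebraMap_mem : ∀ r : k, algebraMap k A r ∈ piece 0
  mul_mem : ∀ {i j : ℕ} {a b : A}, a ∈ piece i → b ∈ piece j → a * b ∈ piece (i + j)

namespace AlgFiltration

variable {k A : Type*} [Field k] [Ring A] [Algebra k A] (F : AlgFiltration k A)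

/-- `A_(i-1)`, with `A_(-1) = 0`. -/
def below : ℕ → Submodule k A
  | 0 => ⊥
  | i + 1 => F.piece i

/-- The homogeneous component `A_(i) / A_(i-1)` of the associated graded algebra. -/
def Component (i : ℕ) : Type _ := F.piece i ⧸ (F.below i).comap (F.piece i).subtype

instance componentAddCommGroup (i : ℕ) : AddCommGroup (F.Component i) :=
  inferInstanceAs (AddCommGroup (F.piece i ⧸ (F.below i).comap (F.piece i).subtype))

instance componentModule (i : ℕ) : Module k (F.Component i) :=
  inferInstanceAs (Module k (F.piece i ⧸ (F.below i).comap (F.piece i).subtype))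

/-- The class in `A_(i) / A_(i-1)` of an element of `A_(i)`. -/
def cls (i : ℕ) (a : A) (ha : a ∈ F.piece i) : F.Component i :=
  Submodule.Quotient.mk (p := (F.below i).comap (F.piece i).subtype) ⟨a, ha⟩

theorem mul_mem_below_left {i j : ℕ} {a b : A} (ha : a ∈ F.below i) (hb : b ∈ F.piece j) :
    a * b ∈ F.below (i + j) := by
  cases i with
  | zero =>
    have : a = 0 := by simpa [below] using ha
    simp [this]
  | succ i =>
    have := F.mul_mem (i := i) ha hb
    rwa [show i + 1 + j = (i + j) + 1 by omega]

theorem mul_mem_below_right {i j : ℕ} {a b : A} (ha : a ∈ F.piece i) (hb : b ∈ F.below j) :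
    a * b ∈ F.below (i + j) := by
  cases j with
  | zero =>
    have : b = 0 := by simpa [below] using hb
    simp [this]
  | succ j => exact F.mul_mem (j := j) ha hb

/-- The product `A_(i)/A_(i-1) × A_(j)/A_(j-1) → A_(i+j)/A_(i+j-1)` induced by that of `A`. -/
def componentMul {i j : ℕ} (x : F.Component i) (y : F.Component j) : F.Component (i + j) :=
  Quotient.liftOn₂' x y (fun a b => F.cls (i + j) (a.1 * b.1) (F.mul_mem a.2 b.2)) (by
    intro a b a' b' h h'
    rw [Submodule.quotientRel_def] at h h'
    refine (Submodule.Quotient.eq _).2 ?_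
    change a.1 * b.1 - a'.1 * b'.1 ∈ F.below (i + j)
    have e : a.1 * b.1 - a'.1 * b'.1 = (a.1 - a'.1) * b.1 + a'.1 * (b.1 - b'.1) := by
      noncomm_ring
    rw [e]
    exact add_mem (F.mul_mem_below_left h b.2) (F.mul_mem_below_right a'.2 h'))

theorem cls_mul {i j : ℕ} {a b : A} (ha : a ∈ F.piece i) (hb : b ∈ F.piece j) :
    F.componentMul (F.cls i a ha) (F.cls j b hb) = F.cls (i + j) (a * b) (F.mul_mem ha hb) := rfl

theorem sigma_ext {i j : ℕ} {a b : A} (hij : i = j) (hab : a = b) (ha : a ∈ F.piece i)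
    (hb : b ∈ F.piece j) :
    (⟨i, F.cls i a ha⟩ : GradedMonoid F.Component) = ⟨j, F.cls j b hb⟩ := by
  subst hij; subst hab; rfl

theorem component_ind {i : ℕ} {p : F.Component i → Prop}
    (h : ∀ (a : A) (ha : a ∈ F.piece i), p (F.cls i a ha)) (x : F.Component i) : p x :=
  Quotient.inductionOn' x (fun a => h a.1 a.2)

theorem cls_congr {i : ℕ} {a b : A} (hab : a = b) (ha : a ∈ F.piece i) (hb : b ∈ F.piece i) :
    F.cls i a ha = F.cls i b hb := by
  subst hab; rfl

theorem one_mem : (1 : A) ∈ F.piece 0 := by simpa using F.algebraMap_mem 1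

instance componentGMul : GradedMonoid.GMul F.Component where
  mul x y := F.componentMul x y

instance componentGOne : GradedMonoid.GOne F.Component where
  one := F.cls 0 1 F.one_mem

noncomputable instance componentGRing : DirectSum.GRing F.Component where
  mul_zero {i j} x := by
    induction x using F.component_ind with
    | h a ha =>
      exact F.cls_congr (mul_zero a) (F.mul_mem ha (zero_mem (F.piece j))) (zero_mem _)
  zero_mul {i j} x := by
    induction x using F.component_ind with
    | h a ha =>
      exact F.cls_congr (zero_mul a) (F.mul_mem (zero_mem (F.piece i)) ha) (zero_mem _)
  mul_add {i j} x y z := by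
    induction x using F.component_ind with
    | h a ha =>
    induction y using F.component_ind with
    | h b hb =>
    induction z using F.component_ind with
    | h c hc =>
      exact F.cls_congr (mul_add a b c) (F.mul_mem ha (add_mem hb hc))
        (add_mem (F.mul_mem ha hb) (F.mul_mem ha hc))
  add_mul {i j} x y z := by
    induction x using F.component_ind with
    | h a ha =>
    induction y using F.component_ind with
    | h b hb =>
    induction z using F.component_ind with
    | h c hc =>
      exact F.cls_congr (add_mul a b c) (F.mul_mem (add_mem ha hb) hc)
        (add_mem (F.mul_mem ha hc) (F.mul_mem hb hc))
  one_mul := by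
    rintro ⟨i, x⟩
    induction x using F.component_ind with
    | h a ha => exact F.sigma_ext (zero_add i) (one_mul a) _ _
  mul_one := by
    rintro ⟨i, x⟩
    induction x using F.component_ind with
    | h a ha => exact F.sigma_ext (add_zero i) (mul_one a) _ _
  mul_assoc := by
    rintro ⟨i, x⟩ ⟨j, y⟩ ⟨l, z⟩
    induction x using F.component_ind with
    | h a ha =>
    induction y using F.component_ind with
    | h b hb =>
    induction z using F.component_ind with
    | h c hc => exact F.sigma_ext (add_assoc i j l) (mul_assoc a b c) _ _
  natCast n := F.cls 0 (n : A) (by simpa using F.algebraMap_mem (n : k))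
  natCast_zero := F.cls_congr Nat.cast_zero _ (zero_mem _)
  natCast_succ n := F.cls_congr (Nat.cast_succ n) _
    (add_mem (by simpa using F.algebraMap_mem (n : k)) F.one_mem)
  intCast n := F.cls 0 (n : A) (by simpa using F.algebraMap_mem (n : k))
  intCast_ofNat n := F.cls_congr (Int.cast_natCast n) _ _
  intCast_negSucc_ofNat n := F.cls_congr (Int.cast_negSucc n) _
    (neg_mem (by simpa using F.algebraMap_mem ((n + 1 : ℕ) : k)))

noncomputable instance componentGAlgebra : DirectSum.GAlgebra k F.Component where
  toFun :=
    { toFun := fun r => F.cls 0 (algebraMap k A r) (F.algebraMap_mem r)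
      map_zero' := F.cls_congr (map_zero _) _ (zero_mem _)
      map_add' := fun r s => F.cls_congr (map_add _ r s) _
        (add_mem (F.algebraMap_mem r) (F.algebraMap_mem s)) }
  map_one := F.cls_congr (map_one _) _ _
  map_mul r s := F.sigma_ext (add_zero 0).symm (map_mul _ r s) _
    (F.mul_mem (F.algebraMap_mem r) (F.algebraMap_mem s))
  commutes r := by
    rintro ⟨i, x⟩
    induction x using F.component_ind with
    | h a ha =>
      exact F.sigma_ext (by omega) (Algebra.commutes r a) (F.mul_mem (F.algebraMap_mem r) ha)
        (F.mul_mem ha (F.algebraMap_mem r))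
  smul_def r := by
    rintro ⟨i, x⟩
    induction x using F.component_ind with
    | h a ha =>
      exact F.sigma_ext (zero_add i).symm (Algebra.smul_def r a) ((F.piece i).smul_mem r ha)
        (F.mul_mem (F.algebraMap_mem r) ha)

/-- The associated graded algebra `gr A = ⨁ A_(i) / A_(i-1)`. -/
abbrev Gr : Type _ := DirectSum ℕ F.Component

/-- The class of `a ∈ A_(i)` in the degree-`i` component of `gr A`. -/
noncomputable def grClass (i : ℕ) (a : A) (ha : a ∈ F.piece i) : F.Gr :=
  DirectSum.of F.Component i (F.cls i a ha)

/-- The subspace of `gr A` induced by a subspace `S` of `A`: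
the direct sum of the images of `S ∩ A_(i)` in `A_(i) / A_(i-1)`. -/
def grSubmodule (S : Submodule k A) : Submodule k F.Gr :=
  Submodule.span k {x | ∃ (i : ℕ) (a : A) (ha : a ∈ F.piece i), a ∈ S ∧ x = F.grClass i a ha}

theorem below_map_le {f : A →ₗ[k] A} (hf : ∀ i, ∀ a ∈ F.piece i, f a ∈ F.piece i) (i : ℕ) :
    ∀ a ∈ F.below i, f a ∈ F.below i := by
  cases i with
  | zero =>
    intro a ha
    have : a = 0 := by simpa [below] using ha
    simp [this]
  | succ i => exact hf i

/-- The map of `gr A` induced by a filtration-preserving linear map of `A`. -/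
noncomputable def grMap (f : A →ₗ[k] A) (hf : ∀ i, ∀ a ∈ F.piece i, f a ∈ F.piece i) :
    F.Gr →ₗ[k] F.Gr :=
  DirectSum.lmap fun i =>
    Submodule.mapQ _ _ (f.restrict (hf i)) (fun a ha => F.below_map_le hf i a.1 ha)

theorem grMap_grClass (f : A →ₗ[k] A) (hf : ∀ i, ∀ a ∈ F.piece i, f a ∈ F.piece i) (i : ℕ)
    (a : A) (ha : a ∈ F.piece i) :
    F.grMap f hf (F.grClass i a ha) = F.grClass i (f a) (hf i a ha) :=
  DirectSum.lmap_lof _ _ _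

theorem grMap_mem (f : A →ₗ[k] A) (hf : ∀ i, ∀ a ∈ F.piece i, f a ∈ F.piece i)
    (S : Submodule k A) (hS : ∀ a ∈ S, f a ∈ S) :
    ∀ x ∈ F.grSubmodule S, F.grMap f hf x ∈ F.grSubmodule S := by
  intro x hx
  induction hx using Submodule.span_induction with
  | mem x hx =>
    obtain ⟨i, a, ha, haS, rfl⟩ := hx
    rw [grMap_grClass]
    exact Submodule.subset_span ⟨i, f a, hf i a ha, hS a haS, rfl⟩
  | zero => simp
  | add x y _ _ hx hy => rw [map_add]; exact add_mem hx hy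
  | smul r x _ hx => rw [map_smul]; exact Submodule.smul_mem _ r hx

end AlgFiltration

/-! ## Layered graphs -/

/-- A directed graph (multiple edges allowed) with vertices in layers `V_0, V_1, …`, whose edges
go down exactly one layer, with `V_0 = {*}`, and such that every vertex outside `V_0` is the
tail of an edge. -/
structure LayeredGraph (V E : Type*) where
  tail : E → V
  head : E → V
  level : V → ℕ
  level_tail : ∀ e, level (tail e) = level (head e) + 1
  star : V
  level_eq_zero_iff : ∀ v, level v = 0 ↔ v = star
  exists_edge : ∀ v, v ≠ star → ∃ e, tail e = v

namespace LayeredGraph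

variable {V E : Type*} (G : LayeredGraph V E)

/-- `G.IsPath v w p`: the nonempty list `p` of edges is a path from `v` to `w`. -/
inductive IsPath : V → V → List E → Prop
  | single (e : E) : IsPath (G.tail e) (G.head e) [e]
  | cons (e : E) {w : V} {p : List E} (hp : IsPath (G.head e) w p) :
      IsPath (G.tail e) w (e :: p)

/-- `v > w`: there is a path from `v` to `w`. -/
def Gt (v w : V) : Prop := ∃ p, G.IsPath v w p

/-- The level of an edge is the level of its tail. -/
def edgeLevel (e : E) : ℕ := G.level (G.tail e)

/-- The sum of the levels of the letters of a word in the edges. -/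
def weight (l : List E) : ℕ := (l.map G.edgeLevel).sum

theorem weight_append (l l' : List E) : G.weight (l ++ l') = G.weight l + G.weight l' := by
  simp [weight]

/-- A level-preserving automorphism of a layered graph. -/
structure Aut where
  onV : Equiv.Perm V
  onE : Equiv.Perm E
  tail_onE : ∀ e, G.tail (onE e) = onV (G.tail e)
  head_onE : ∀ e, G.head (onE e) = onV (G.head e)
  level_onV : ∀ v, G.level (onV v) = G.level v

/-- A choice of a distinguished edge `e_v` with tail `v`, for each vertex `v ≠ *`. -/
structure DistinguishedEdges where
  edge : ∀ v, v ≠ G.star → E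
  tail_edge : ∀ v hv, G.tail (edge v hv) = v

open Classical in
/-- Starting at `v`, follow distinguished edges for at most `n` steps or until reaching `*`. -/
noncomputable def DistinguishedEdges.follow {G : LayeredGraph V E} (D : G.DistinguishedEdges) :
    ℕ → V → List E
  | 0, _ => []
  | n + 1, v => if hv : v = G.star then [] else D.edge v hv :: D.follow n (G.head (D.edge v hv))

/-- The distinguished path from `v` to `*`; it has length `|v|`. -/
noncomputable def DistinguishedEdges.path {G : LayeredGraph V E} (D : G.DistinguishedEdges)
    (v : V) : List E :=
  D.follow (G.level v) v

/-! ## The algebra of a layered graph -/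

section Algebra

variable (k : Type*) [Field k]

/-- `e(π, m) = ∑_{i₁ < ⋯ < i_m} e_{i₁} ⋯ e_{i_m}` in the free algebra on the edges, for
`π = (e_1, …, e_n)`. -/
noncomputable def pathElement (p : List E) (m : ℕ) : FreeAlgebra k E :=
  ((p.sublistsLen m).map fun s => (s.map (FreeAlgebra.ι k)).prod).sum

/-- The defining relations `e(π₁, m) = e(π₂, m)` for parallel paths `π₁`, `π₂`. -/
inductive Rel : FreeAlgebra k E → FreeAlgebra k E → Prop
  | mk {v w : V} {p q : List E} (hp : G.IsPath v w p) (hq : G.IsPath v w q) (m : ℕ)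
      (hm : 1 ≤ m) (hm' : m ≤ p.length) : Rel (pathElement k p m) (pathElement k q m)

/-- The algebra `A(Γ) = T(E) / R`, where `R` is the two-sided ideal generated by the relations. -/
abbrev Alg : Type _ := RingQuot (G.Rel k)

/-- The image in `A(Γ)` of a word in the edges. -/
noncomputable def word (l : List E) : G.Alg k :=
  RingQuot.mkAlgHom k (G.Rel k) (l.map (FreeAlgebra.ι k)).prod

theorem word_append (l l' : List E) : G.word k (l ++ l') = G.word k l * G.word k l' := by
  simp [word]

/-- `A(Γ)_[d]`, spanned by the words of length `d`. -/
noncomputable def degreePart (d : ℕ) : Submodule k (G.Alg k) :=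
  Submodule.span k {x | ∃ l : List E, l.length = d ∧ x = G.word k l}

/-- The filtration of `A(Γ)`: `A(Γ)_(i)` is spanned by the words whose letters have levels of
sum at most `i`. -/
noncomputable def filtration : AlgFiltration k (G.Alg k) where
  piece i := Submodule.span k {x | ∃ l : List E, G.weight l ≤ i ∧ x = G.word k l}
  mono i j hij := Submodule.span_mono (by rintro x ⟨l, hl, rfl⟩; exact ⟨l, hl.trans hij, rfl⟩)
  algebraMap_mem r := by
    rw [Algebra.algebraMap_eq_smul_one]
    exact Submodule.smul_mem _ _ (Submodule.subset_span ⟨[], by simp [weight], by simp [word]⟩)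
  mul_mem {i j a b} ha hb := by
    have h := Submodule.mul_mem_mul ha hb
    rw [Submodule.span_mul_span] at h
    refine Submodule.span_mono ?_ h
    rintro _ ⟨_, ⟨l, hl, rfl⟩, _, ⟨l', hl', rfl⟩, rfl⟩
    exact ⟨l ++ l', by rw [weight_append]; omega, (G.word_append k l l').symm⟩

theorem word_mem (l : List E) : G.word k l ∈ (G.filtration k).piece (G.weight l) :=
  Submodule.subset_span ⟨l, le_rfl, rfl⟩

/-- The associated graded algebra `gr A(Γ)` of the filtered algebra `A(Γ)`. -/
abbrev GrAlg : Type _ := (G.filtration k).Gr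

/-- `(gr A(Γ))_[d]`, the part of `gr A(Γ)` that comes from `A(Γ)_[d]`. -/
noncomputable def grDegreePart (d : ℕ) : Submodule k (G.GrAlg k) :=
  (G.filtration k).grSubmodule (G.degreePart k d)

/-- The class in `gr A(Γ)` of a word in the edges. -/
noncomputable def grWord (l : List E) : G.GrAlg k :=
  (G.filtration k).grClass (G.weight l) (G.word k l) (G.word_mem k l)

/-- The element `e(v, m)` of `gr A(Γ)`: the class of the product of the first `m` edges of the
distinguished path from `v` to `*`. -/
noncomputable def grElement {G : LayeredGraph V E} (D : G.DistinguishedEdges) (v : V) (m : ℕ) :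
    G.GrAlg k :=
  G.grWord k ((D.path v).take m)

end Algebra

/-! ## The action of an automorphism -/

section Action

variable {G : LayeredGraph V E} (σ : G.Aut) (k : Type*) [Field k]

theorem Aut.isPath_map {v w : V} {p : List E} (hp : G.IsPath v w p) :
    G.IsPath (σ.onV v) (σ.onV w) (p.map σ.onE) := by
  induction hp with
  | single e =>
    rw [← σ.tail_onE, ← σ.head_onE]
    exact IsPath.single _
  | cons e hp ih =>
    rw [← σ.tail_onE]
    rw [← σ.head_onE] at ih
    exact IsPath.cons _ ih

theorem Aut.weight_map (l : List E) : G.weight (l.map σ.onE) = G.weight l := by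
  simp only [weight, List.map_map]
  congr 2
  funext e
  simp [edgeLevel, σ.tail_onE, σ.level_onV]

/-- The automorphism of the free algebra on the edges induced by `σ`. -/
noncomputable def Aut.onFree : FreeAlgebra k E →ₐ[k] FreeAlgebra k E :=
  FreeAlgebra.lift k fun e => FreeAlgebra.ι k (σ.onE e)

theorem Aut.onFree_prod (l : List E) :
    σ.onFree k (l.map (FreeAlgebra.ι k)).prod = ((l.map σ.onE).map (FreeAlgebra.ι k)).prod := by
  rw [map_list_prod, List.map_map, List.map_map]
  congr 2
  funext e
  simp [Aut.onFree]

theorem sublistsLen_map' {α β : Type*} (f : α → β) :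
    ∀ (m : ℕ) (l : List α), (l.map f).sublistsLen m = (l.sublistsLen m).map (List.map f)
  | 0, l => by simp
  | m + 1, [] => by simp
  | m + 1, a :: l => by
    simp [sublistsLen_map' f (m + 1) l, sublistsLen_map' f m l, Function.comp_def]

theorem Aut.onFree_pathElement (p : List E) (m : ℕ) :
    σ.onFree k (pathElement k p m) = pathElement k (p.map σ.onE) m := by
  unfold pathElement
  rw [map_list_sum, sublistsLen_map', List.map_map, List.map_map]
  congr 2
  funext s
  exact σ.onFree_prod k s

/-- The algebra endomorphism of `A(Γ)` induced by `σ`, sending the generator `e` to `σ(e)`. -/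
noncomputable def Aut.onAlg : G.Alg k →ₐ[k] G.Alg k :=
  RingQuot.liftAlgHom k ⟨(RingQuot.mkAlgHom k (G.Rel k)).comp (σ.onFree k), by
    rintro _ _ ⟨hp, hq, m, hm, hm'⟩
    rw [AlgHom.comp_apply, AlgHom.comp_apply, σ.onFree_pathElement, σ.onFree_pathElement]
    exact RingQuot.mkAlgHom_rel k
      (Rel.mk (σ.isPath_map hp) (σ.isPath_map hq) m hm (by simpa using hm'))⟩

theorem Aut.onAlg_word (l : List E) : σ.onAlg k (G.word k l) = G.word k (l.map σ.onE) := by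
  unfold word Aut.onAlg
  rw [RingQuot.liftAlgHom_mkAlgHom_apply, AlgHom.comp_apply, σ.onFree_prod]

theorem Aut.onAlg_mem_piece (i : ℕ) :
    ∀ a ∈ (G.filtration k).piece i, (σ.onAlg k).toLinearMap a ∈ (G.filtration k).piece i := by
  intro a ha
  suffices h : (G.filtration k).piece i ≤
      ((G.filtration k).piece i).comap (σ.onAlg k).toLinearMap from h ha
  refine Submodule.span_le.2 ?_
  rintro _ ⟨l, hl, rfl⟩
  refine Submodule.subset_span ⟨l.map σ.onE, by rwa [σ.weight_map], σ.onAlg_word k l⟩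

theorem Aut.onAlg_mem_degreePart (d : ℕ) :
    ∀ a ∈ G.degreePart k d, (σ.onAlg k).toLinearMap a ∈ G.degreePart k d := by
  intro a ha
  suffices h : G.degreePart k d ≤
      (G.degreePart k d).comap (σ.onAlg k).toLinearMap from h ha
  refine Submodule.span_le.2 ?_
  rintro _ ⟨l, hl, rfl⟩
  refine Submodule.subset_span ⟨l.map σ.onE, by simpa using hl, σ.onAlg_word k l⟩

/-- The map of `gr A(Γ)` induced by `σ`. -/
noncomputable def Aut.onGr : G.GrAlg k →ₗ[k] G.GrAlg k :=
  (G.filtration k).grMap (σ.onAlg k).toLinearMap (σ.onAlg_mem_piece k)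

theorem Aut.onGr_mem_grDegreePart (d : ℕ) :
    ∀ x ∈ G.grDegreePart k d, σ.onGr k x ∈ G.grDegreePart k d :=
  (G.filtration k).grMap_mem _ _ _ (σ.onAlg_mem_degreePart k d)

/-- The graded trace `∑ tr(σ | A(Γ)_[d]) t^d`. -/
noncomputable def Aut.gradedTraceAlg : PowerSeries k :=
  PowerSeries.mk fun d =>
    LinearMap.trace k _ ((σ.onAlg k).toLinearMap.restrict (σ.onAlg_mem_degreePart k d))

/-- The graded trace `∑ tr(σ | (gr A(Γ))_[d]) t^d`. -/
noncomputable def Aut.gradedTraceGr : PowerSeries k :=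
  PowerSeries.mk fun d =>
    LinearMap.trace k _ ((σ.onGr k).restrict (σ.onGr_mem_grDegreePart k d))

/-! ## The subalgebra of the fixed subgraph -/

/-- `(v, m)` covers `(w, n)`: `v > w` and `m = |v| - |w|`. -/
def Covers (G : LayeredGraph V E) (x y : V × ℕ) : Prop :=
  G.Gt x.1 y.1 ∧ x.2 + G.level y.1 = G.level x.1

/-- The index sequences `((v_1, m_1), …, (v_l, m_l))`, `l ≥ 0`, with all `v_i ≠ *` fixed by `σ`,
`1 ≤ m_i ≤ |v_i|`, and no entry covering the next one. -/
def Aut.IsFixedNormal (s : List (V × ℕ)) : Prop :=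
  (∀ x ∈ s, σ.onV x.1 = x.1 ∧ x.1 ≠ G.star ∧ 1 ≤ x.2 ∧ x.2 ≤ G.level x.1) ∧
    s.IsChain (fun x y => ¬ G.Covers x y)

/-- `A(Γ^σ) ⊆ gr A(Γ)`: the span of the products `e(v_1, m_1) ⋯ e(v_l, m_l)` over the sequences
above. -/
noncomputable def Aut.fixedPart (D : G.DistinguishedEdges) : Submodule k (G.GrAlg k) :=
  Submodule.span k
    {x | ∃ s, σ.IsFixedNormal s ∧ x = (s.map fun y => grElement k D y.1 y.2).prod}

/-- The Hilbert series `∑ dim (A(Γ^σ) ∩ (gr A(Γ))_[d]) t^d` of `A(Γ^σ)`. -/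
noncomputable def Aut.fixedHilbertSeries (D : G.DistinguishedEdges) : PowerSeries ℤ :=
  PowerSeries.mk fun d =>
    (Module.finrank k ↥(σ.fixedPart k D ⊓ G.grDegreePart k d) : ℤ)

end Action

/-! ## Chains of fixed vertices -/

section Chains

variable {G : LayeredGraph V E}

theorem Gt.level_lt {v w : V} (h : G.Gt v w) : G.level w < G.level v := by
  obtain ⟨p, hp⟩ := h
  induction hp with
  | single e => have := G.level_tail e; omega
  | cons e hp ih => have := G.level_tail e; omega

/-- The chains `v_1 > ⋯ > v_l`, `l ≥ 1`, of vertices fixed by `σ`. -/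
def Aut.FixedChain (σ : G.Aut) : Type _ :=
  {c : List V // c ≠ [] ∧ (∀ v ∈ c, σ.onV v = v) ∧ c.IsChain G.Gt}

theorem nodup_of_isChain {c : List V} (h : c.IsChain G.Gt) : c.Nodup := by
  have h1 : c.IsChain (fun v w => G.level w < G.level v) := h.imp fun _ _ h => Gt.level_lt h
  have : IsTrans V (fun v w => G.level w < G.level v) := ⟨fun _ _ _ h h' => h'.trans h⟩
  refine (List.isChain_iff_pairwise.1 h1).imp ?_
  rintro v _ h rfl
  exact lt_irrefl _ h

instance Aut.FixedChain.finite [Finite V] (σ : G.Aut) : Finite σ.FixedChain := by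
  classical
  have := Fintype.ofFinite V
  exact Finite.of_injective
    (fun c : σ.FixedChain => (⟨c.1, nodup_of_isChain c.2.2.2⟩ : {l : List V // l.Nodup}))
    (fun c d h => Subtype.ext (congrArg (fun x : {l : List V // l.Nodup} => x.1) h))

noncomputable instance Aut.FixedChain.fintype [Finite V] (σ : G.Aut) : Fintype σ.FixedChain :=
  Fintype.ofFinite _

/-- The polynomial `∑ (-1)^(l-1) t^(|v_1| - |v_l|)` over the chains `v_1 > ⋯ > v_l ≥ *` of
vertices fixed by `σ`. -/
noncomputable def Aut.chainSum [Finite V] (σ : G.Aut) : Polynomial ℤ :=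
  ∑ c : σ.FixedChain, (-1) ^ (c.1.length - 1) *
    Polynomial.X ^ (G.level (c.1.head c.2.1) - G.level (c.1.getLast c.2.1))

end Chains

end LayeredGraph

/-! Call a product of letters e(v,j), 1 ≤ j ≤ |v|, normal if no letter covers the next. The normal
monomials form a basis of A(Γ), adapted to the weight filtration, so their classes form a basis of
gr A(Γ). The relations make e(v,j) independent of the path from v to *, hence σ sends e(v,j) to
e(σv,j) and permutes this basis. In degree d its trace, on either algebra, is the number of normal
words all of whose vertices are fixed by σ. This is also the dimension of the degree d part of
A(Γ^σ), which is spanned by the classes of these words. What remains is to count them.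

Spanning (`degLe_le_monLe`): modulo lower weight, e(v,j) is the product of the first j edges of any
path from v to *. If (v,j) covers (w,m), a path from v through w shows that e(v,j)e(w,m) and
e(v,j+m) agree modulo lower weight. Covering pairs can thus be merged until the word is normal, and
the error terms are absorbed by induction on the weight. In gr A(Γ) the merging is an equality that
introduces no new vertex, so A(Γ^σ) is closed under products.

Independence (`linearIndependent_mon`): A(Γ) is made to act on the space of all words in the letters
by operators X_{v,j} representing e(v,j). With P_v = ∑ X_{v,j} t^j (j ≥ 0, X_{v,0} = 1), the
relations hold once P_v = (1 + t(X_{v,1} - X_{w,1})) P_w for every edge from v to w. Read P_v as the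
linear recurrence s(n+|v|) + ∑_{j≥1} X_{v,j} s(n+|v|-j) = 0 on sequences of word vectors. The
factorization follows if every solution for w is a solution for v (`coeffOp_succ`). The operators
are therefore built by induction on the level: on the sum of the solution spaces of the vertices
below v the recurrence dictates the value, and on a complement the operator prepends letters. The
crux is that sequences without covered words do form a complement (`isCompl_insert`,
`isCompl_seqSup_normSub`). A normal monomial then sends the empty word to the corresponding word
(`rep_mon`).

Counting (`one_sub_X_mul_genFun`): let H count the fixed normal words, h_v those starting at v, and
let c_v be the signed sum over chains of fixed vertices starting at v. Removing the first letter of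
a word and the first vertex of a chain gives matching recursions, whence (1-t) h_v = t H (c_v - [v =
*]). Summing over v and using H = 1 + ∑ h_v gives the formula. -/

namespace LayeredGraph

/-! ### Operators on the word space, constructed from linear recurrences -/

section Recurrence

variable {V E : Type*} (G : LayeredGraph V E)

theorem IsPath.append {u v w : V} {p q : List E} (hp : G.IsPath u v p) (hq : G.IsPath v w q) :
    G.IsPath u w (p ++ q) := by
  induction hp with
  | single e => exact IsPath.cons e hq
  | cons e hp ih => exact IsPath.cons e (ih hq)

theorem Gt.trans {G : LayeredGraph V E} {u v w : V} (h : G.Gt u v) (h' : G.Gt v w) : G.Gt u w := by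
  obtain ⟨p, hp⟩ := h
  obtain ⟨q, hq⟩ := h'
  exact ⟨p ++ q, hp.append G hq⟩

theorem gt_edge (e : E) : G.Gt (G.tail e) (G.head e) := ⟨[e], IsPath.single e⟩

/-- The word starts with a letter `(v, m)`, `1 ≤ m ≤ |v|`, which does not cover the head of the
rest. -/
def HeadAt : V → List (V × ℕ) → Prop
  | _, [] => False
  | v, x :: n => x.1 = v ∧ 1 ≤ x.2 ∧ x.2 ≤ G.level v ∧
      ∀ u, G.Gt v u → x.2 + G.level u = G.level v → ¬ HeadAt u n

theorem HeadAt.eq {G : LayeredGraph V E} {v w : V} {n : List (V × ℕ)} (h : G.HeadAt v n)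
    (h' : G.HeadAt w n) : v = w := by
  cases n with
  | nil => exact h.elim
  | cons x n => exact h.1.symm.trans h'.1

variable (k : Type*) [Field k]

/-- The space with basis the words in the letters `(v, m)`. -/
abbrev WordSpace (_ : LayeredGraph V E) (k : Type*) [Field k] : Type _ := List (V × ℕ) →₀ k

/-- Sequences of elements of the word space. -/
abbrev Seq (G : LayeredGraph V E) (k : Type*) [Field k] : Type _ := ℕ → G.WordSpace k

/-- The sequence `i ↦ s (n + i)`. -/
noncomputable def shift (n : ℕ) : G.Seq k →ₗ[k] G.Seq k := LinearMap.funLeft k _ (fun i => n + i)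

theorem shift_apply (n : ℕ) (s : G.Seq k) (i : ℕ) : G.shift k n s i = s (n + i) := rfl

theorem shift_shift (n m : ℕ) (s : G.Seq k) :
    G.shift k n (G.shift k m s) = G.shift k (m + n) s := by
  funext i
  simp [shift_apply, add_assoc]

variable {k}

/-- The sequences satisfying the recurrence `s (n + d) = - f (s n, s (n + 1), …)`. -/
def recSub (d : ℕ) (f : G.Seq k →ₗ[k] G.WordSpace k) : Submodule k (G.Seq k) where
  carrier := {s | ∀ n, s (n + d) + f (G.shift k n s) = 0}
  add_mem' {a b} ha hb n := by
    have h1 := ha n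
    have h2 := hb n
    rw [map_add, map_add, Pi.add_apply,
      add_add_add_comm, h1, h2, add_zero]
  zero_mem' n := by simp
  smul_mem' c a ha n := by
    rw [map_smul, map_smul, Pi.smul_apply, ← smul_add, ha n, smul_zero]

theorem shift_mem_recSub {d : ℕ} {f : G.Seq k →ₗ[k] G.WordSpace k} {s : G.Seq k}
    (hs : s ∈ G.recSub d f) (m : ℕ) : G.shift k m s ∈ G.recSub d f := by
  intro n
  rw [shift_shift, shift_apply, ← add_assoc]
  exact hs (m + n)

variable (k)

/-- The map `s ↦ ∑_{p < |v|} (v, |v| - p) · s p`. -/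
noncomputable def prepend (v : V) : G.Seq k →ₗ[k] G.WordSpace k :=
  ∑ p ∈ Finset.range (G.level v),
    (Finsupp.lmapDomain k k (List.cons (v, G.level v - p))) ∘ₗ LinearMap.proj p

theorem prepend_apply (v : V) (s : G.Seq k) :
    G.prepend k v s = ∑ p ∈ Finset.range (G.level v),
      Finsupp.mapDomain (List.cons (v, G.level v - p)) (s p) := by
  simp [prepend, Finsupp.lmapDomain_apply]

/-- The sequences whose entry at `|u|` involves no word with head at `u`, for `u ∈ S`. -/
noncomputable def normSub (S : Set V) : Submodule k (G.Seq k) :=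
  ⨅ u ∈ S, (Finsupp.supported k k {n | ¬ G.HeadAt u n}).comap (LinearMap.proj (G.level u))

theorem mem_normSub {S : Set V} {s : G.Seq k} :
    s ∈ G.normSub k S ↔ ∀ u ∈ S, ∀ n, s (G.level u) n ≠ 0 → ¬ G.HeadAt u n := by
  simp only [normSub, Submodule.mem_iInf, Submodule.mem_comap, Finsupp.mem_supported]
  refine forall₂_congr fun u _ => ?_
  simp [Set.subset_def]

open Classical in
/-- The operator `s ↦ ∑_j X_{v,j} s(|v| - j)`, where `X_{v,j}` represents the coefficient `e(v,j)`:
normal words are prepended, and sequences that satisfy the recurrence of a vertex below `v` also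
satisfy that of `v`. -/
noncomputable def recOp (v : V) : G.Seq k →ₗ[k] G.WordSpace k :=
  -- The first summand consists of solutions for lower vertices, and the value -s(|v|) there is the
  -- recurrence of v at n = 0. The complement property is itself proved from the operators of lower
  -- vertices; `regular` shows that the value 0 never occurs when V is finite.
  if h : IsCompl (⨆ u : {u // G.Gt v u}, G.recSub (G.level u.1) (recOp u.1))
      (G.normSub k {u | G.Gt v u}) then
    G.prepend k v ∘ₗ (LinearMap.id - Submodule.projection _ _ h) -
      LinearMap.proj (G.level v) ∘ₗ Submodule.projection _ _ h
  else 0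
termination_by G.level v
decreasing_by all_goals exact Gt.level_lt u.2

/-- The sequences satisfying the recurrence of `v`. -/
noncomputable def seqSub (v : V) : Submodule k (G.Seq k) := G.recSub (G.level v) (G.recOp k v)

/-- The sum of the spaces of sequences of the vertices in `S`. -/
noncomputable def seqSup (S : Set V) : Submodule k (G.Seq k) := ⨆ u ∈ S, G.seqSub k u

theorem seqSub_le_seqSup {S : Set V} {u : V} (hu : u ∈ S) : G.seqSub k u ≤ G.seqSup k S :=
  le_biSup (G.seqSub k) hu

theorem seqSup_mono {S T : Set V} (h : S ⊆ T) : G.seqSup k S ≤ G.seqSup k T :=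
  biSup_mono fun _ hu => h hu

/-- The complement property that makes the operator of `v` well defined. -/
def Regular (v : V) : Prop :=
  IsCompl (G.seqSup k {u | G.Gt v u}) (G.normSub k {u | G.Gt v u})

open Classical in
theorem recOp_eq (v : V) : G.recOp k v =
    if h : G.Regular k v then
      G.prepend k v ∘ₗ (LinearMap.id - Submodule.projection _ _ h) -
        LinearMap.proj (G.level v) ∘ₗ Submodule.projection _ _ h
    else 0 := by
  have e : G.seqSup k {u | G.Gt v u} =
      ⨆ u : {u // G.Gt v u}, G.recSub (G.level u.1) (G.recOp k u.1) := by
    rw [seqSup, iSup_subtype]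
    rfl
  rw [recOp]
  simp only [Regular, e]

variable {k} {G}

theorem Regular.recOp_of_mem_normSub {v : V} (h : G.Regular k v) {s : G.Seq k}
    (hs : s ∈ G.normSub k {u | G.Gt v u}) : G.recOp k v s = G.prepend k v s := by
  rw [recOp_eq, dif_pos h]
  have : Submodule.projection _ _ h s = 0 := (Submodule.projection_apply_eq_zero_iff h).2 hs
  simp [this]

theorem Regular.recOp_of_mem_seqSup {v : V} (h : G.Regular k v) {s : G.Seq k}
    (hs : s ∈ G.seqSup k {u | G.Gt v u}) : s (G.level v) + G.recOp k v s = 0 := by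
  rw [recOp_eq, dif_pos h]
  have : Submodule.projection _ _ h s = s := Submodule.projection_apply_of_mem_left h hs
  simp [this]

/-- The definition of `recOp` imposes the recurrence of v only at n = 0; stability of the solution
space of u under shifts gives it at every n. -/
theorem Regular.seqSub_le {v u : V} (h : G.Regular k v) (hu : G.Gt v u) :
    G.seqSub k u ≤ G.seqSub k v := by
  intro s hs n
  have := h.recOp_of_mem_seqSup (G.seqSub_le_seqSup k (S := {u | G.Gt v u}) hu
    (G.shift_mem_recSub hs n))
  exact this

/-- A sequence vanishing below |v| lies in `normSub`, since the vertices below v have smaller level.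
There the operator is `prepend`, which reads only those entries. Hence the recurrence of v really
has order |v|. -/
theorem Regular.recOp_congr {v : V} (h : G.Regular k v) {s t : G.Seq k}
    (hst : ∀ p < G.level v, s p = t p) : G.recOp k v s = G.recOp k v t := by
  rw [← sub_eq_zero, ← map_sub, h.recOp_of_mem_normSub, prepend_apply]
  · refine Finset.sum_eq_zero fun p hp => ?_
    rw [Pi.sub_apply, hst p (Finset.mem_range.1 hp), sub_self, Finsupp.mapDomain_zero]
  · rw [mem_normSub]
    intro u hu n hn
    rw [Pi.sub_apply, hst _ (Gt.level_lt hu), sub_self] at hn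
    exact (hn rfl).elim

/-- The words with head at `v` or at a vertex below `v`. -/
def HeadLE (G : LayeredGraph V E) (v : V) (n : List (V × ℕ)) : Prop :=
  ∃ u, (u = v ∨ G.Gt v u) ∧ G.HeadAt u n

/-- The letter (v, |v| - p) could cover a head u below v only when |u| = p, and `normSub` excludes
words with head u from the entry at |u|. -/
theorem headAt_of_prepend {v : V} {s : G.Seq k} (hs : s ∈ G.normSub k {u | G.Gt v u})
    {n : List (V × ℕ)} (hn : G.prepend k v s n ≠ 0) : G.HeadAt v n := by
  classical
  rw [prepend_apply, Finsupp.finsetSum_apply] at hn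
  obtain ⟨p, hp, hpn⟩ := Finset.exists_ne_zero_of_sum_ne_zero hn
  rw [Finset.mem_range] at hp
  have hn' := Finsupp.mapDomain_support (Finsupp.mem_support_iff.2 hpn)
  obtain ⟨n', hn'', rfl⟩ := Finset.mem_image.1 hn'
  refine ⟨rfl, by simp only; omega, by simp only; omega, fun u hu hl => ?_⟩
  have : p = G.level u := by simp only at hl; omega
  subst this
  exact (mem_normSub _ _).1 hs u hu n' (Finsupp.mem_support_iff.1 hn'')

/-- Prepending produces words with head v. The other part of the value is an entry of a sum of
solutions for vertices u below v; by the recurrence of u it is a value of the operator of u, so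
induction on the level applies. -/
theorem headLE_recOp (v : V) (s : G.Seq k) (n : List (V × ℕ)) (hn : G.recOp k v s n ≠ 0) :
    G.HeadLE v n := by
  induction hl : G.level v using Nat.strong_induction_on generalizing n v s with
  | _ l ih =>
  subst hl
  by_cases h : G.Regular k v
  · have h1 := Submodule.sub_projection_mem h s
    have h2 := Submodule.projection_apply_mem h s
    set t := Submodule.projection _ _ h s
    have e : G.recOp k v s = G.prepend k v (s - t) - t (G.level v) := by
      rw [recOp_eq, dif_pos h]; rfl
    rw [e, Finsupp.sub_apply] at hn
    by_cases hn1 : G.prepend k v (s - t) n = 0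
    · have hn2 : t (G.level v) n ≠ 0 := by
        intro h0; rw [hn1, h0, sub_zero] at hn; exact hn rfl
      have key : G.seqSup k {u | G.Gt v u} ≤
          (Finsupp.supported k k {n | G.HeadLE v n}).comap (LinearMap.proj (G.level v)) := by
        refine iSup₂_le fun u hu r hr => ?_
        rw [Submodule.mem_comap, LinearMap.proj_apply, Finsupp.mem_supported]
        intro m hm
        have hlt := Gt.level_lt hu
        have := hr (G.level v - G.level u)
        rw [Nat.sub_add_cancel hlt.le] at this
        rw [eq_neg_of_add_eq_zero_left this] at hm
        obtain ⟨w, hw, hwm⟩ := ih _ hlt u _ m (by simpa using hm) rfl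
        refine ⟨w, Or.inr ?_, hwm⟩
        rcases hw with rfl | hw
        · exact hu
        · exact Gt.trans hu hw
      have hsupp : t (G.level v) ∈ Finsupp.supported k k {n | G.HeadLE v n} := key h2
      exact (Finsupp.mem_supported _ _).1 hsupp (Finsupp.mem_support_iff.2 hn2)
    · exact ⟨v, Or.inl rfl, headAt_of_prepend h1 hn1⟩
  · rw [recOp_eq, dif_neg h] at hn
    exact (hn rfl).elim

theorem headLE_of_mem_seqSub {v : V} {s : G.Seq k} (hs : s ∈ G.seqSub k v) {i : ℕ}
    (hi : G.level v ≤ i) {n : List (V × ℕ)} (hn : s i n ≠ 0) : G.HeadLE v n := by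
  have := hs (i - G.level v)
  rw [Nat.sub_add_cancel hi] at this
  rw [eq_neg_of_add_eq_zero_left this] at hn
  exact headLE_recOp v _ n (by simpa using hn)

/-- The solution of a recurrence with a given window. -/
noncomputable def extend (d : ℕ) (f : G.Seq k →ₗ[k] G.WordSpace k) (r : G.Seq k) :
    ℕ → G.WordSpace k := fun i =>
  -- The argument of f is cut off at d to make the recursion well founded; by `Regular.recOp_congr`
  -- this does not change the value of the operators used later.
  if i < d then r i else -f fun p => if p < d then extend d f r (i - d + p) else 0
termination_by i => i
decreasing_by omega

theorem extend_of_lt {d : ℕ} (f : G.Seq k →ₗ[k] G.WordSpace k) (r : G.Seq k) {i : ℕ}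
    (hi : i < d) : extend d f r i = r i := by
  rw [extend, if_pos hi]

theorem Regular.extend_mem {v : V} (h : G.Regular k v) (r : G.Seq k) :
    extend (G.level v) (G.recOp k v) r ∈ G.seqSub k v := by
  intro n
  rw [extend, if_neg (by omega), neg_add_eq_sub, sub_eq_zero]
  refine h.recOp_congr fun p hp => ?_
  rw [if_pos hp, shift_apply, Nat.add_sub_cancel]

theorem Regular.eq_zero_of_window {v : V} (h : G.Regular k v) {s : G.Seq k}
    (hs : s ∈ G.seqSub k v) (h0 : ∀ p < G.level v, s p = 0) : s = 0 := by
  funext i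
  induction i using Nat.strong_induction_on with
  | _ i ih =>
  by_cases hi : i < G.level v
  · exact h0 i hi
  · have := hs (i - G.level v)
    rw [Nat.sub_add_cancel (by omega), h.recOp_congr (t := 0), map_zero, add_zero] at this
    · exact this
    · intro p hp
      rw [shift_apply]
      exact ih _ (by omega)

theorem prepend_injective_window {v : V} {s : G.Seq k} (h : G.prepend k v s = 0) {p : ℕ}
    (hp : p < G.level v) : s p = 0 := by
  ext n
  have := DFunLike.congr_fun h ((v, G.level v - p) :: n)
  rw [prepend_apply, Finsupp.finsetSum_apply, Finset.sum_eq_single p] at this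
  · rwa [Finsupp.mapDomain_apply (List.cons_injective)] at this
  · intro q hq hqp
    rw [Finset.mem_range] at hq
    refine Finsupp.mapDomain_of_notMem_range _ _ ?_
    rintro ⟨n', hn'⟩
    simp only [List.cons.injEq, Prod.mk.injEq, true_and] at hn'
    omega
  · intro hq
    exact (hq (Finset.mem_range.2 hp)).elim

/-- A combination of words with head at `v` is obtained by prepending letters to a window without
covered words. -/
theorem exists_prepend_eq {v : V} {x : G.WordSpace k} (hx : ∀ n, x n ≠ 0 → G.HeadAt v n) :
    ∃ r ∈ G.normSub k {u | G.Gt v u}, G.prepend k v r = x := by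
  induction x using Finsupp.induction with
  | zero => exact ⟨0, zero_mem _, map_zero _⟩
  | single_add n c x hn hc ih =>
    obtain ⟨r, hr, hrx⟩ := ih fun m hm => hx m (by
      have : m ≠ n := by rintro rfl; exact hn (Finsupp.mem_support_iff.2 hm)
      rwa [Finsupp.add_apply, Finsupp.single_eq_of_ne this, zero_add])
    have hn' := hx n (by
      rw [Finsupp.add_apply, Finsupp.single_eq_same, Finsupp.notMem_support_iff.1 hn, add_zero]
      exact hc)
    obtain - | ⟨⟨w, j⟩, n⟩ := n
    · exact hn'.elim
    obtain ⟨rfl, h1, h2, h3⟩ := hn'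
    simp only at h1 h2 h3
    refine ⟨Pi.single (G.level w - j) (Finsupp.single n c) + r, add_mem ?_ hr, ?_⟩
    · rw [mem_normSub]
      intro u hu m hm
      have hju : G.level u = G.level w - j := by
        by_contra hne
        rw [Pi.single_eq_of_ne hne] at hm
        exact hm rfl
      rw [hju, Pi.single_eq_same] at hm
      have hmn : m = n := by
        by_contra hne
        rw [Finsupp.single_eq_of_ne hne] at hm
        exact hm rfl
      subst hmn
      exact h3 u hu (by omega)
    · rw [map_add, hrx, prepend_apply, Finset.sum_eq_single (G.level w - j)]
      · rw [Pi.single_eq_same, Finsupp.mapDomain_single]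
        congr 3
        simp only [Prod.mk.injEq, true_and]
        exact Nat.sub_sub_self h2
      · intro q _ hq
        rw [Pi.single_eq_of_ne hq, Finsupp.mapDomain_zero]
      · intro hq
        rw [Finset.mem_range] at hq
        exact (hq (Nat.sub_lt (lt_of_lt_of_le h1 h2) h1)).elim

/-- Adding to `S` a vertex `w` of maximal level preserves the complement property. -/
theorem isCompl_insert {S : Set V} {w : V} (hwS : w ∉ S) (hS : ∀ u, G.Gt w u → u ∈ S)
    (hdown : ∀ u ∈ S, ∀ u', G.Gt u u' → u' ∈ S) (hmax : ∀ u ∈ S, G.level u ≤ G.level w)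
    (hw : G.Regular k w) (h : IsCompl (G.seqSup k S) (G.normSub k S)) :
    IsCompl (G.seqSup k (insert w S)) (G.normSub k (insert w S)) := by
  classical
  have hSw : G.seqSup k {u | G.Gt w u} ≤ G.seqSup k S := G.seqSup_mono k hS
  -- As |u| ≤ |w|, the entry at |w| of a solution for u ∈ S is an output of the recurrence, so its
  -- heads are u or below u. They lie in the down-closed set S, which omits w.
  have hentry : ∀ s ∈ G.seqSup k S, ∀ n, G.HeadAt w n → s (G.level w) n = 0 := by
    intro s hs n hn
    have : G.seqSup k S ≤
        (Finsupp.supported k k {n | ¬ G.HeadAt w n}).comap (LinearMap.proj (G.level w)) := by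
      refine iSup₂_le fun u hu r hr => ?_
      rw [Submodule.mem_comap, LinearMap.proj_apply, Finsupp.mem_supported]
      intro m hm hwm
      obtain ⟨u', hu', hum⟩ :=
        headLE_of_mem_seqSub hr (hmax u hu) (Finsupp.mem_support_iff.1 hm)
      obtain rfl := hum.eq hwm
      rcases hu' with rfl | hu'
      · exact hwS hu
      · exact hwS (hdown u hu _ hu')
    by_contra hne
    have hsupp : s (G.level w) ∈ Finsupp.supported k k {n | ¬ G.HeadAt w n} := this hs
    exact (Finsupp.mem_supported _ _).1 hsupp (Finsupp.mem_support_iff.2 hne) hn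
  have hins : G.seqSup k (insert w S) = G.seqSub k w ⊔ G.seqSup k S := by
    rw [seqSup, iSup_insert, ← seqSup]
  have hnorm : ∀ s, s ∈ G.normSub k (insert w S) ↔
      (∀ n, s (G.level w) n ≠ 0 → ¬ G.HeadAt w n) ∧ s ∈ G.normSub k S := by
    intro s
    simp only [mem_normSub, Set.forall_mem_insert]
  constructor
  · rw [Submodule.disjoint_def]
    intro s hs hsn
    rw [hins, Submodule.mem_sup] at hs
    obtain ⟨x, hx, s', hs', rfl⟩ := hs
    rw [hnorm] at hsn
    -- The part x' of x comes from vertices below w, hence from S. The rest x - x' solves the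
    -- recurrence of w without covered words, so its entry at |w| is minus a prepending, supported
    -- on words with head w. Nothing else can cancel these, so the prepending is 0, and with it the
    -- window and all of x - x'.
    have h1 := Submodule.sub_projection_mem hw x
    have h2 := Submodule.projection_apply_mem hw x
    set x' := Submodule.projection _ _ hw x
    have h2' : x' ∈ G.seqSub k w :=
      (iSup₂_le fun u hu => hw.seqSub_le hu : G.seqSup k {u | G.Gt w u} ≤ _) h2
    have h3 : x - x' ∈ G.seqSub k w := sub_mem hx h2'
    have h4 : (x - x') (G.level w) = - G.prepend k w (x - x') := by
      have := h3 0
      rw [hw.recOp_congr (t := x - x') (fun p _ => by rw [shift_apply, zero_add]), zero_add,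
        hw.recOp_of_mem_normSub h1] at this
      exact eq_neg_of_add_eq_zero_left this
    have h5 : G.prepend k w (x - x') = 0 := by
      ext n
      by_contra hne
      have hn := headAt_of_prepend h1 hne
      have e : (x + s') (G.level w) n = (x - x') (G.level w) n + (x' + s') (G.level w) n := by
        rw [← Finsupp.add_apply, ← Pi.add_apply, show x + s' = (x - x') + (x' + s') by abel]
      rw [hentry _ (add_mem (hSw h2) hs') n hn, add_zero, h4] at e
      refine hsn.1 n ?_ hn
      rw [e, Finsupp.neg_apply]
      exact neg_ne_zero.2 hne
    have h6 : x - x' = 0 :=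
      hw.eq_zero_of_window h3 fun p hp => prepend_injective_window h5 hp
    rw [sub_eq_zero] at h6
    have h7 : x ∈ G.seqSup k S := by rw [h6]; exact hSw h2
    exact (Submodule.disjoint_def.1 h.disjoint) _ (add_mem h7 hs') hsn.2
  · rw [codisjoint_iff, eq_top_iff]
    rintro s -
    -- The window is chosen so that the solution for w that extends it has, at |w|, exactly the part
    -- of s(|w|) with head w; the sign is that of the recurrence. Subtracting it reduces the claim
    -- to S.
    obtain ⟨r, hr, hrx⟩ := exists_prepend_eq (v := w)
      (x := -(s (G.level w)).filter (G.HeadAt w)) (by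
        intro n hn
        by_contra hne
        rw [Finsupp.neg_apply, Finsupp.filter_apply_neg _ _ hne] at hn
        simp at hn)
    set x : G.Seq k := extend (G.level w) (G.recOp k w) r
    have hx : x ∈ G.seqSub k w := hw.extend_mem r
    have hxw : x (G.level w) = (s (G.level w)).filter (G.HeadAt w) := by
      have := hx 0
      rw [hw.recOp_congr (t := r)
        (fun p hp => by rw [shift_apply, zero_add]; exact extend_of_lt _ _ hp),
        zero_add, hw.recOp_of_mem_normSub hr, hrx] at this
      rwa [← sub_eq_add_neg, sub_eq_zero] at this
    have h1 := Submodule.sub_projection_mem h (s - x)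
    have h2 := Submodule.projection_apply_mem h (s - x)
    set s' := Submodule.projection _ _ h (s - x)
    have e : s = (x + s') + (s - x - s') := by abel
    rw [e]
    refine Submodule.add_mem_sup ?_ ?_
    · rw [hins]
      exact Submodule.add_mem_sup hx h2
    · rw [hnorm]
      refine ⟨fun n hn hwn => hn ?_, h1⟩
      rw [Pi.sub_apply, Pi.sub_apply, hxw, Finsupp.sub_apply, Finsupp.sub_apply,
        Finsupp.filter_apply_pos _ _ hwn, hentry _ h2 n hwn]
      simp

variable (k G)

theorem isCompl_seqSup_normSub (S : Finset V)
    (hdown : ∀ u ∈ S, ∀ u', G.Gt u u' → u' ∈ S) :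
    IsCompl (G.seqSup k (S : Set V)) (G.normSub k (S : Set V)) := by
  classical
  induction hc : S.card using Nat.strong_induction_on generalizing S with
  | _ c ih =>
  subst hc
  obtain rfl | hne := S.eq_empty_or_nonempty
  · simpa [seqSup, normSub] using isCompl_bot_top
  · obtain ⟨w, hw, hmax⟩ := S.exists_max_image G.level hne
    have hcard := Finset.card_erase_lt_of_mem hw
    have hdown' : ∀ u ∈ S.erase w, ∀ u', G.Gt u u' → u' ∈ S.erase w := by
      intro u hu u' huu'
      replace hu := Finset.mem_of_mem_erase hu
      refine Finset.mem_erase.2 ⟨?_, hdown u hu u' huu'⟩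
      rintro rfl
      have := Gt.level_lt huu'
      have := hmax u hu
      omega
    have hsub : ∀ u, G.Gt w u → u ∈ S.erase w := by
      intro u hu
      refine Finset.mem_erase.2 ⟨?_, hdown w hw u hu⟩
      rintro rfl
      exact lt_irrefl _ (Gt.level_lt hu)
    -- Regularity of w is the complement property for the set of vertices below w, which is
    -- down-closed and smaller than S.
    have hreg : G.Regular k w := by
      have e : {u | G.Gt w u} = ((S.filter (G.Gt w) : Finset V) : Set V) := by
        ext u
        simpa using fun h => hdown w hw u h
      rw [Regular, e]
      refine ih _ (lt_of_le_of_lt (Finset.card_le_card ?_) hcard) _ ?_ rfl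
      · intro u hu
        exact hsub u (Finset.mem_filter.1 hu).2
      · intro u hu u' huu'
        rw [Finset.mem_filter] at hu ⊢
        exact ⟨hdown u hu.1 u' huu', hu.2.trans huu'⟩
    have := isCompl_insert (S := ((S.erase w : Finset V) : Set V)) (w := w) (by simp)
      (fun u hu => Finset.mem_coe.2 (hsub u hu))
      (fun u hu u' h => Finset.mem_coe.2 (hdown' u (Finset.mem_coe.1 hu) u' h))
      (fun u hu => hmax u (Finset.mem_of_mem_erase (Finset.mem_coe.1 hu))) hreg
      (ih _ hcard _ hdown' rfl)
    rwa [← Finset.coe_insert, Finset.insert_erase hw] at this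

theorem regular [Finite V] (v : V) : G.Regular k v := by
  classical
  have := Fintype.ofFinite V
  have := G.isCompl_seqSup_normSub k (Finset.univ.filter (G.Gt v)) (by
    intro u hu u' h
    rw [Finset.mem_filter] at hu ⊢
    exact ⟨Finset.mem_univ _, hu.2.trans h⟩)
  simpa [Regular] using this

/-- The operator `X_{v,j}` on the word space. -/
noncomputable def coeffOp (v : V) (j : ℕ) : Module.End k (G.WordSpace k) :=
  if j = 0 then 1 else if j ≤ G.level v then
    G.recOp k v ∘ₗ LinearMap.single k (fun _ => G.WordSpace k) (G.level v - j) else 0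

theorem coeffOp_zero (v : V) : G.coeffOp k v 0 = 1 := if_pos rfl

theorem coeffOp_of_lt {v : V} {j : ℕ} (h : G.level v < j) : G.coeffOp k v j = 0 := by
  rw [coeffOp, if_neg (by omega), if_neg (by omega)]

theorem coeffOp_apply {v : V} {j : ℕ} (h1 : 1 ≤ j) (h2 : j ≤ G.level v) (x : G.WordSpace k) :
    G.coeffOp k v j x = G.recOp k v (Pi.single (G.level v - j) x) := by
  rw [coeffOp, if_neg (by omega), if_pos h2]
  rfl

/-- Only the window matters, and a window is a finite sum of sequences with a single nonzero entry.
-/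
theorem recOp_eq_sum [Finite V] (v : V) (s : G.Seq k) :
    G.recOp k v s = ∑ p ∈ Finset.range (G.level v), G.coeffOp k v (G.level v - p) (s p) := by
  rw [(G.regular k v).recOp_congr
    (t := ∑ p ∈ Finset.range (G.level v), Pi.single p (s p)), map_sum]
  · refine Finset.sum_congr rfl fun p hp => ?_
    rw [Finset.mem_range] at hp
    rw [coeffOp_apply _ _ (by omega) (by omega), Nat.sub_sub_self hp.le]
  · intro p hp
    rw [Finset.sum_apply, Finset.sum_eq_single p]
    · simp
    · intro q _ hq
      rw [Pi.single_eq_of_ne hq.symm]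
    · intro h
      exact (h (Finset.mem_range.2 hp)).elim

/-- The operators satisfy `P_v = (1 + t (X_{v,1} - X_{w,1})) P_w` when `v` is right above `w`. -/
theorem coeffOp_succ [Finite V] {v w : V} (hvw : G.Gt v w) (hl : G.level v = G.level w + 1)
    (j : ℕ) : G.coeffOp k v (j + 1) = G.coeffOp k w (j + 1) +
      (G.coeffOp k v 1 - G.coeffOp k w 1) * G.coeffOp k w j := by
  rcases Nat.eq_zero_or_pos j with rfl | hj
  · rw [coeffOp_zero, mul_one, zero_add]; abel
  by_cases hjw : j ≤ G.level w
  swap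
  · rw [G.coeffOp_of_lt k (v := v) (by omega), G.coeffOp_of_lt k (v := w) (j := j + 1) (by omega),
      G.coeffOp_of_lt k (v := w) (j := j) (by omega)]
    simp
  refine LinearMap.ext fun x => ?_
  set r : G.Seq k := Pi.single (G.level w - j) x with hr
  -- The test sequence is the solution for w whose window is x at |w| - j and 0 elsewhere; its next
  -- entry is -X_{w,j} x.
  set s : G.Seq k := extend (G.level w) (G.recOp k w) r with hsdef
  have hs : s ∈ G.seqSub k w := (G.regular k w).extend_mem r
  have hsv : s ∈ G.seqSub k v := (G.regular k v).seqSub_le hvw hs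
  have hsr : ∀ p < G.level w, s p = r p := fun p hp => extend_of_lt _ _ hp
  have e0 : s (G.level w) = - G.coeffOp k w j x := by
    have := hs 0
    rw [zero_add, (G.regular k w).recOp_congr (t := r)
      (fun p hp => by rw [shift_apply, zero_add]; exact hsr p hp)] at this
    rw [coeffOp_apply _ _ hj hjw]
    exact eq_neg_of_add_eq_zero_left this
  -- The recurrence of w at n = 1 and that of v at n = 0 both determine s(|w| + 1). In each sum only
  -- the entries x and s(|w|) survive, and equating the two gives the identity.
  have e1 := hs 1
  have e2 := hsv 0
  rw [recOp_eq_sum] at e1 e2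
  obtain ⟨m, hm⟩ : ∃ m, G.level w = m + 1 := ⟨G.level w - 1, by omega⟩
  have f2 : ∑ p ∈ Finset.range (G.level w),
      G.coeffOp k v (G.level v - p) (G.shift k 0 s p) = G.coeffOp k v (j + 1) x := by
    rw [Finset.sum_eq_single (G.level w - j)]
    · rw [shift_apply, zero_add, hsr _ (by omega), hr, Pi.single_eq_same]
      congr 2
      omega
    · intro p hp hpj
      rw [shift_apply, zero_add, hsr _ (Finset.mem_range.1 hp), hr, Pi.single_eq_of_ne hpj, map_zero]
    · intro h
      rw [Finset.mem_range] at h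
      omega
  have f1 : ∑ p ∈ Finset.range m,
      G.coeffOp k w (G.level w - p) (G.shift k 1 s p) = G.coeffOp k w (j + 1) x := by
    by_cases hjm : j ≤ m
    · rw [Finset.sum_eq_single (m - j)]
      · rw [shift_apply, hsr _ (by omega), hr, show 1 + (m - j) = G.level w - j by omega,
          Pi.single_eq_same]
        congr 2
        omega
      · intro p hp hpj
        rw [Finset.mem_range] at hp
        rw [shift_apply, hsr _ (by omega), hr, Pi.single_eq_of_ne (by omega), map_zero]
      · intro h
        rw [Finset.mem_range] at h
        omega
    · rw [G.coeffOp_of_lt k (v := w) (j := j + 1) (by omega), LinearMap.zero_apply]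
      refine Finset.sum_eq_zero fun p hp => ?_
      rw [Finset.mem_range] at hp
      rw [shift_apply, hsr _ (by omega), hr, Pi.single_eq_of_ne (by omega), map_zero]
  rw [hl, Finset.sum_range_succ, ← hl, f2, zero_add, hl] at e2
  rw [hm, Finset.sum_range_succ, ← hm, f1, show 1 + G.level w = G.level w + 1 by omega] at e1
  have g1 : G.shift k 1 s m = s (G.level w) := by rw [shift_apply]; congr 1; omega
  have g2 : G.shift k 0 s (G.level w) = s (G.level w) := by rw [shift_apply, zero_add]
  rw [g1, e0, show G.level w - m = 1 by omega] at e1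
  rw [g2, e0, show G.level w + 1 - G.level w = 1 by omega] at e2
  rw [LinearMap.add_apply, Module.End.mul_apply, LinearMap.sub_apply]
  rw [map_neg] at e1 e2
  rw [← sub_eq_zero, ← sub_eq_zero.2 (e2.trans e1.symm)]
  abel

/-- Normal letters act by prepending. -/
theorem coeffOp_single [Finite V] {v : V} {j : ℕ} {n : List (V × ℕ)}
    (h : G.HeadAt v ((v, j) :: n)) :
    G.coeffOp k v j (Finsupp.single n 1) = Finsupp.single ((v, j) :: n) 1 := by
  obtain ⟨-, h1, h2, h3⟩ := h
  simp only at h1 h2 h3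
  rw [coeffOp_apply _ _ h1 h2, (G.regular k v).recOp_of_mem_normSub, prepend_apply,
    Finset.sum_eq_single (G.level v - j)]
  · rw [Pi.single_eq_same, Finsupp.mapDomain_single, Nat.sub_sub_self h2]
  · intro q _ hq
    rw [Pi.single_eq_of_ne hq, Finsupp.mapDomain_zero]
  · intro h
    rw [Finset.mem_range] at h
    omega
  · rw [mem_normSub]
    intro u hu m hm
    have hju : G.level u = G.level v - j := by
      by_contra hne
      rw [Pi.single_eq_of_ne hne] at hm
      exact hm rfl
    rw [hju, Pi.single_eq_same] at hm
    have hmn : m = n := by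
      by_contra hne
      rw [Finsupp.single_eq_of_ne hne] at hm
      exact hm rfl
    subst hmn
    exact h3 u hu (by omega)

end Recurrence

end LayeredGraph

namespace LayeredGraph

/-! ### The action of the free algebra and its generating functions -/

section PathElement

variable {V E : Type*} (G : LayeredGraph V E) (k : Type*) [Field k]

theorem pathElement_zero (p : List E) : pathElement k p 0 = 1 := by
  simp [pathElement]

theorem pathElement_nil_succ (m : ℕ) : pathElement k ([] : List E) (m + 1) = 0 := by
  simp [pathElement]

theorem pathElement_cons_succ (e : E) (p : List E) (m : ℕ) :
    pathElement k (e :: p) (m + 1) =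
      pathElement k p (m + 1) + FreeAlgebra.ι k e * pathElement k p m := by
  simp only [pathElement, List.sublistsLen_succ_cons, List.map_append, List.sum_append,
    List.map_map]
  congr 1
  rw [← List.sum_map_mul_left]
  rfl

variable {G} in
theorem IsPath.level_eq {v w : V} {p : List E} (hp : G.IsPath v w p) :
    G.level v = G.level w + p.length := by
  induction hp with
  | single e => simpa using G.level_tail e
  | cons e hp ih => rw [G.level_tail, ih, List.length_cons, add_assoc]

/-- The generating function of the operators `X_{v,j}`. -/
noncomputable def opSeries (v : V) : PowerSeries (Module.End k (G.WordSpace k)) :=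
  PowerSeries.mk (G.coeffOp k v)

/-- The operator of an edge. -/
noncomputable def edgeOp (e : E) : Module.End k (G.WordSpace k) :=
  G.coeffOp k (G.tail e) 1 - G.coeffOp k (G.head e) 1

/-- The action of the free algebra on the word space. -/
noncomputable def freeRep : FreeAlgebra k E →ₐ[k] Module.End k (G.WordSpace k) :=
  FreeAlgebra.lift k (G.edgeOp k)

/-- The generating function of the operators of the elements `e(p, j)`. -/
noncomputable def pathSeries (p : List E) : PowerSeries (Module.End k (G.WordSpace k)) :=
  PowerSeries.mk fun j => G.freeRep k (pathElement k p j)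

theorem pathSeries_nil : G.pathSeries k [] = 1 := by
  ext1 j
  rw [pathSeries, PowerSeries.coeff_mk, PowerSeries.coeff_one]
  cases j with
  | zero => simp [pathElement_zero]
  | succ j => simp [pathElement_nil_succ]

theorem pathSeries_cons (e : E) (p : List E) : G.pathSeries k (e :: p) =
    G.pathSeries k p + PowerSeries.X * (PowerSeries.C (G.edgeOp k e) * G.pathSeries k p) := by
  ext1 j
  cases j with
  | zero => simp [pathSeries, pathElement_zero]
  | succ j =>
    rw [map_add, PowerSeries.coeff_succ_X_mul, PowerSeries.coeff_C_mul]
    simp [pathSeries, pathElement_cons_succ, freeRep]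

theorem opSeries_tail [Finite V] (e : E) : G.opSeries k (G.tail e) = G.opSeries k (G.head e) +
    PowerSeries.X * (PowerSeries.C (G.edgeOp k e) * G.opSeries k (G.head e)) := by
  ext1 j
  cases j with
  | zero => simp [opSeries, coeffOp_zero]
  | succ j =>
    rw [map_add, PowerSeries.coeff_succ_X_mul, PowerSeries.coeff_C_mul]
    simp only [opSeries, PowerSeries.coeff_mk]
    exact G.coeffOp_succ k (G.gt_edge e) (G.level_tail e) j

theorem opSeries_eq [Finite V] {v w : V} {p : List E} (hp : G.IsPath v w p) :
    G.opSeries k v = G.pathSeries k p * G.opSeries k w := by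
  induction hp with
  | single e =>
    rw [pathSeries_cons, pathSeries_nil, opSeries_tail, add_mul, one_mul, mul_assoc, mul_assoc,
      one_mul]
  | cons e hp ih => rw [pathSeries_cons, opSeries_tail, ih, add_mul, mul_assoc, mul_assoc]

theorem opSeries_star : G.opSeries k G.star = 1 := by
  ext1 j
  rw [opSeries, PowerSeries.coeff_mk, PowerSeries.coeff_one]
  have := (G.level_eq_zero_iff G.star).2 rfl
  cases j with
  | zero => simp [coeffOp_zero]
  | succ j => rw [coeffOp_of_lt _ _ (by omega)]; simp

end PathElement

/-- In the coefficient of degree n, every term except the one at (n, 0) agrees on both sides by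
induction, so additive cancellation in R suffices. -/
theorem powerSeries_mul_right_cancel {R : Type*} [Semiring R]
    (hR : ∀ x y z : R, x + z = y + z → x = y) {a a' b : PowerSeries R}
    (hb : PowerSeries.coeff 0 b = 1) (h : a * b = a' * b) : a = a' := by
  classical
  ext1 n
  induction n using Nat.strong_induction_on with
  | _ n ih =>
  have := congrArg (PowerSeries.coeff n) h
  have hn : (n, 0) ∈ Finset.HasAntidiagonal.antidiagonal n := by simp
  rw [PowerSeries.coeff_mul, PowerSeries.coeff_mul, ← Finset.add_sum_erase _ _ hn,
    ← Finset.add_sum_erase _ _ hn] at this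
  rw [hb, mul_one, mul_one] at this
  rw [Finset.sum_congr rfl (g := fun p => PowerSeries.coeff p.1 a' * PowerSeries.coeff p.2 b)]
    at this
  · exact hR _ _ _ this
  · rintro ⟨i, j⟩ hij
    rw [Finset.mem_erase, Finset.HasAntidiagonal.mem_antidiagonal] at hij
    obtain ⟨hne, hij⟩ := hij
    simp only at hij
    have hj : j ≠ 0 := by
      rintro rfl
      exact hne (by simpa using hij)
    rw [ih i (by omega)]

/-! ### The action of A(Γ) and independence of the normal monomials -/

section Normal

variable {V E : Type*} (G : LayeredGraph V E) (k : Type*) [Field k]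

/-- The series of either path, multiplied by P_w, equals P_v, and P_w has constant coefficient 1. -/
theorem freeRep_pathElement_eq [Finite V] {v w : V} {p q : List E} (hp : G.IsPath v w p)
    (hq : G.IsPath v w q) (j : ℕ) :
    G.freeRep k (pathElement k p j) = G.freeRep k (pathElement k q j) := by
  have hw : PowerSeries.coeff 0 (G.opSeries k w) = 1 := by
    rw [opSeries, PowerSeries.coeff_mk, coeffOp_zero]
  have := powerSeries_mul_right_cancel
    (fun x y z h => LinearMap.ext fun m => add_right_cancel (LinearMap.congr_fun h m)) hw
    ((G.opSeries_eq k hp).symm.trans (G.opSeries_eq k hq))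
  simpa [pathSeries] using congrArg (PowerSeries.coeff j) this

/-- The action of `A(Γ)` on the word space. -/
noncomputable def rep [Finite V] : G.Alg k →ₐ[k] Module.End k (G.WordSpace k) :=
  RingQuot.liftAlgHom k ⟨G.freeRep k, by
    rintro _ _ ⟨hp, hq, m, -, -⟩
    exact G.freeRep_pathElement_eq k hp hq m⟩

/-- The element of `A(Γ)` given by `e(p, j)`. -/
noncomputable def pathElt (p : List E) (j : ℕ) : G.Alg k :=
  RingQuot.mkAlgHom k (G.Rel k) (pathElement k p j)

theorem rep_pathElt [Finite V] (p : List E) (j : ℕ) :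
    G.rep k (G.pathElt k p j) = G.freeRep k (pathElement k p j) := by
  rw [rep, pathElt, RingQuot.liftAlgHom_mkAlgHom_apply]

variable {G} in
theorem IsPath.pathElt_eq {v w : V} {p q : List E} (hp : G.IsPath v w p) (hq : G.IsPath v w q)
    {j : ℕ} (h1 : 1 ≤ j) (h2 : j ≤ p.length) : G.pathElt k p j = G.pathElt k q j :=
  RingQuot.mkAlgHom_rel k (Rel.mk hp hq j h1 h2)

variable {G}

theorem ne_star_of_level {v : V} {j : ℕ} (h1 : 1 ≤ j) (h2 : j ≤ G.level v) : v ≠ G.star := by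
  rintro rfl
  have := (G.level_eq_zero_iff G.star).2 rfl
  omega

theorem DistinguishedEdges.isPath (D : G.DistinguishedEdges) {v : V} (hv : v ≠ G.star) :
    G.IsPath v G.star (D.path v) := by
  obtain ⟨n, hn⟩ : ∃ n, G.level v = n + 1 :=
    Nat.exists_eq_succ_of_ne_zero fun h => hv ((G.level_eq_zero_iff v).1 h)
  rw [path, hn]
  induction n generalizing v with
  | zero =>
    have hl := G.level_tail (D.edge v hv)
    rw [D.tail_edge, hn] at hl
    have := (G.level_eq_zero_iff _).1 (Nat.succ.inj hl).symm
    have h := IsPath.single (G := G) (D.edge v hv)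
    rw [D.tail_edge, this] at h
    simpa [follow, hv] using h
  | succ n ih =>
    have hl := G.level_tail (D.edge v hv)
    rw [D.tail_edge, hn] at hl
    have hl' : G.level (G.head (D.edge v hv)) = n + 1 := (Nat.succ.inj hl).symm
    have h := IsPath.cons (G := G) (D.edge v hv)
      (ih (ne_star_of_level le_add_self hl'.ge) hl')
    rw [D.tail_edge] at h
    rw [follow, dif_neg hv]
    exact h

variable (D : G.DistinguishedEdges)

/-- The element `e(v, j)` of `A(Γ)`. -/
noncomputable def DistinguishedEdges.elt (x : V × ℕ) : G.Alg k := G.pathElt k (D.path x.1) x.2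

/-- The product of the elements `e(v_i, j_i)` of `A(Γ)`. -/
noncomputable def DistinguishedEdges.mon (s : List (V × ℕ)) : G.Alg k := (s.map (D.elt k)).prod

variable (G) in
/-- Words in the letters `(v, j)` with `1 ≤ j ≤ |v|`. -/
def IsLetterWord (s : List (V × ℕ)) : Prop := ∀ x ∈ s, 1 ≤ x.2 ∧ x.2 ≤ G.level x.1

variable (G) in
/-- Words in the letters `(v, j)` with `1 ≤ j ≤ |v|`, none of which covers the next one. -/
def IsNormal (s : List (V × ℕ)) : Prop :=
  G.IsLetterWord s ∧ s.IsChain fun x y => ¬ G.Covers x y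

theorem IsNormal.tail {x : V × ℕ} {s : List (V × ℕ)} (h : G.IsNormal (x :: s)) : G.IsNormal s :=
  ⟨fun y hy => h.1 y (List.mem_cons_of_mem _ hy), h.2.tail⟩

theorem IsNormal.headAt {x : V × ℕ} {s : List (V × ℕ)} (h : G.IsNormal (x :: s)) :
    G.HeadAt x.1 (x :: s) := by
  obtain ⟨h1, h2⟩ := h.1 x List.mem_cons_self
  refine ⟨rfl, h1, h2, fun u hu hl hs => ?_⟩
  cases s with
  | nil => exact hs
  | cons y s =>
    obtain rfl := hs.1
    exact (List.isChain_cons_cons.1 h.2).1 ⟨hu, hl⟩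

/-- Since P_* = 1, the series of the distinguished path from v to * is P_v itself. -/
theorem rep_elt [Finite V] {x : V × ℕ} (h1 : 1 ≤ x.2) (h2 : x.2 ≤ G.level x.1) :
    G.rep k (D.elt k x) = G.coeffOp k x.1 x.2 := by
  rw [DistinguishedEdges.elt, rep_pathElt]
  have := G.opSeries_eq k (D.isPath (ne_star_of_level h1 h2))
  rw [opSeries_star, mul_one] at this
  simpa [opSeries, pathSeries] using (congrArg (PowerSeries.coeff x.2) this).symm

/-- The rightmost letter acts first, and each further letter meets a normal word whose head it does
not cover, so it is simply prepended. -/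
theorem rep_mon [Finite V] {s : List (V × ℕ)} (h : G.IsNormal s) :
    G.rep k (D.mon k s) (Finsupp.single [] 1) = Finsupp.single s 1 := by
  induction s with
  | nil => simp [DistinguishedEdges.mon]
  | cons x s ih =>
    obtain ⟨h1, h2⟩ := h.1 x List.mem_cons_self
    have := ih h.tail
    rw [DistinguishedEdges.mon] at this ⊢
    rw [List.map_cons, List.prod_cons, map_mul, Module.End.mul_apply, this, rep_elt k D h1 h2]
    exact G.coeffOp_single k h.headAt

theorem linearIndependent_mon [Finite V] :
    LinearIndependent k fun s : {s // G.IsNormal s} => D.mon k s.1 := by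
  refine LinearIndependent.of_comp
    (LinearMap.applyₗ (Finsupp.single [] 1) ∘ₗ (G.rep k).toLinearMap) ?_
  have e : (LinearMap.applyₗ (Finsupp.single [] 1) ∘ₗ (G.rep k).toLinearMap) ∘
      (fun s : {s // G.IsNormal s} => D.mon k s.1) =
      (fun s : List (V × ℕ) => Finsupp.single s (1 : k)) ∘ Subtype.val := by
    funext s
    exact rep_mon k D s.2
  rw [e]
  exact (Finsupp.linearIndependent_single_one k _).comp _ Subtype.val_injective

end Normal

end LayeredGraph

namespace LayeredGraph

/-! ### Leading terms, merging, and spanning by normal monomials -/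

section Spanning

variable {V E : Type*} (G : LayeredGraph V E) (k : Type*) [Field k]

/-- The span of the words of length `d` and weight at most `i`. -/
noncomputable def degLe (d i : ℕ) : Submodule k (G.Alg k) :=
  Submodule.span k {x | ∃ l : List E, (l.length = d ∧ G.weight l ≤ i) ∧ x = G.word k l}

/-- The span of the words of length `d` and weight less than `i`. -/
noncomputable def degLt (d i : ℕ) : Submodule k (G.Alg k) :=
  Submodule.span k {x | ∃ l : List E, (l.length = d ∧ G.weight l < i) ∧ x = G.word k l}

variable {G k}

theorem word_mem_degLe (l : List E) : G.word k l ∈ G.degLe k l.length (G.weight l) :=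
  Submodule.subset_span ⟨l, ⟨rfl, le_rfl⟩, rfl⟩

theorem degLe_le_degLt {d i j : ℕ} (h : i < j) : G.degLe k d i ≤ G.degLt k d j :=
  Submodule.span_mono (by rintro x ⟨l, ⟨h1, h2⟩, rfl⟩; exact ⟨l, ⟨h1, h2.trans_lt h⟩, rfl⟩)

theorem degLt_le_degLe {d i : ℕ} : G.degLt k d i ≤ G.degLe k d i :=
  Submodule.span_mono (by rintro x ⟨l, ⟨h1, h2⟩, rfl⟩; exact ⟨l, ⟨h1, h2.le⟩, rfl⟩)

theorem degLe_mono {d i j : ℕ} (h : i ≤ j) : G.degLe k d i ≤ G.degLe k d j :=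
  Submodule.span_mono (by rintro x ⟨l, ⟨h1, h2⟩, rfl⟩; exact ⟨l, ⟨h1, h2.trans h⟩, rfl⟩)

theorem mul_mem_span_word {P Q R : List E → Prop}
    (h : ∀ l l', P l → Q l' → R (l ++ l')) {a b : G.Alg k}
    (ha : a ∈ Submodule.span k {x | ∃ l, P l ∧ x = G.word k l})
    (hb : b ∈ Submodule.span k {x | ∃ l, Q l ∧ x = G.word k l}) :
    a * b ∈ Submodule.span k {x | ∃ l, R l ∧ x = G.word k l} := by
  have hab := Submodule.mul_mem_mul ha hb
  rw [Submodule.span_mul_span] at hab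
  refine Submodule.span_mono ?_ hab
  rintro _ ⟨_, ⟨l, hl, rfl⟩, _, ⟨l', hl', rfl⟩, rfl⟩
  exact ⟨l ++ l', h l l' hl hl', (G.word_append k l l').symm⟩

theorem mul_mem_degLe {d d' i i' : ℕ} {a b : G.Alg k} (ha : a ∈ G.degLe k d i)
    (hb : b ∈ G.degLe k d' i') : a * b ∈ G.degLe k (d + d') (i + i') :=
  mul_mem_span_word (fun l l' h h' => by
    rw [List.length_append, weight_append]; omega) ha hb

theorem mul_mem_degLt_left {d d' i i' : ℕ} {a b : G.Alg k} (ha : a ∈ G.degLt k d i)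
    (hb : b ∈ G.degLe k d' i') : a * b ∈ G.degLt k (d + d') (i + i') :=
  mul_mem_span_word (fun l l' h h' => by
    rw [List.length_append, weight_append]; omega) ha hb

theorem mul_mem_degLt_right {d d' i i' : ℕ} {a b : G.Alg k} (ha : a ∈ G.degLe k d i)
    (hb : b ∈ G.degLt k d' i') : a * b ∈ G.degLt k (d + d') (i + i') :=
  mul_mem_span_word (fun l l' h h' => by
    rw [List.length_append, weight_append]; omega) ha hb

variable (G k)

/-- Congruence modulo lower weight of elements of given length and weight. -/
structure Cong (d i : ℕ) (a b : G.Alg k) : Prop where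
  left : a ∈ G.degLe k d i
  right : b ∈ G.degLe k d i
  sub : a - b ∈ G.degLt k d i

variable {G k}

theorem Cong.refl {d i : ℕ} {a : G.Alg k} (ha : a ∈ G.degLe k d i) : G.Cong k d i a a :=
  ⟨ha, ha, by rw [sub_self]; exact zero_mem _⟩

theorem Cong.symm {d i : ℕ} {a b : G.Alg k} (h : G.Cong k d i a b) : G.Cong k d i b a :=
  ⟨h.right, h.left, by rw [← neg_sub]; exact neg_mem h.sub⟩

theorem Cong.trans {d i : ℕ} {a b c : G.Alg k} (h : G.Cong k d i a b) (h' : G.Cong k d i b c) :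
    G.Cong k d i a c :=
  ⟨h.left, h'.right, by rw [← sub_add_sub_cancel a b c]; exact add_mem h.sub h'.sub⟩

theorem Cong.mul {d i d' i' : ℕ} {a b a' b' : G.Alg k} (h : G.Cong k d i a b)
    (h' : G.Cong k d' i' a' b') : G.Cong k (d + d') (i + i') (a * a') (b * b') :=
  ⟨mul_mem_degLe h.left h'.left, mul_mem_degLe h.right h'.right, by
    have e : a * a' - b * b' = (a - b) * a' + b * (a' - b') := by
      rw [sub_mul, mul_sub, sub_add_sub_cancel]
    rw [e]
    exact add_mem (mul_mem_degLt_left h.sub h'.left) (mul_mem_degLt_right h.right h'.sub)⟩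

/-- The sum `n + (n - 1) + ⋯` with `j` terms. -/
def fallingSum (n j : ℕ) : ℕ := ∑ i ∈ Finset.range j, (n - i)

theorem fallingSum_zero (n : ℕ) : fallingSum n 0 = 0 := by simp [fallingSum]

theorem fallingSum_succ (n j : ℕ) : fallingSum (n + 1) (j + 1) = n + 1 + fallingSum n j := by
  rw [fallingSum, Finset.sum_range_succ', fallingSum, add_comm]
  simp

theorem fallingSum_one (n : ℕ) : fallingSum n 1 = n := by simp [fallingSum]

theorem fallingSum_add (n m j : ℕ) :
    fallingSum n (m + j) = fallingSum n m + fallingSum (n - m) j := by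
  simp [fallingSum, Finset.sum_range_add, Nat.sub_sub]

theorem fallingSum_lt (n j : ℕ) : fallingSum n (j + 1) < fallingSum (n + 1) (j + 1) := by
  rw [fallingSum, Finset.sum_range_succ', fallingSum, Finset.sum_range_succ']
  refine add_lt_add_of_le_of_lt (Finset.sum_le_sum fun i _ => by omega) (by omega)

theorem pathElt_zero (p : List E) : G.pathElt k p 0 = G.word k [] := by
  simp [pathElt, pathElement_zero, word]

theorem pathElt_nil_succ (j : ℕ) : G.pathElt k [] (j + 1) = 0 := by
  simp [pathElt, pathElement_nil_succ]

theorem pathElt_cons_succ (e : E) (p : List E) (j : ℕ) : G.pathElt k (e :: p) (j + 1) =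
    G.pathElt k p (j + 1) + G.word k [e] * G.pathElt k p j := by
  simp [pathElt, pathElement_cons_succ, word]

/-- In e(ep, j+1) = e(p, j+1) + e · e(p, j) the first summand starts one level lower, so it has
smaller weight (`fallingSum_lt`), and only the second contributes to the leading term. The
hypothesis on p is stated with a level n so that the empty path is allowed. -/
theorem cong_pathElt_cons {n : ℕ} {e : E} {p : List E} (he : G.edgeLevel e = n + 1)
    (hp : ∀ j, G.pathElt k p j ∈ G.degLe k j (fallingSum n j) ∧
      (j ≤ p.length → G.Cong k j (fallingSum n j) (G.pathElt k p j) (G.word k (p.take j))))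
    (j : ℕ) : G.pathElt k (e :: p) j ∈ G.degLe k j (fallingSum (n + 1) j) ∧
      (j ≤ (e :: p).length → G.Cong k j (fallingSum (n + 1) j) (G.pathElt k (e :: p) j)
        (G.word k ((e :: p).take j))) := by
  cases j with
  | zero =>
    have : G.pathElt k (e :: p) 0 ∈ G.degLe k 0 (fallingSum (n + 1) 0) := by
      rw [pathElt_zero, fallingSum_zero]
      exact word_mem_degLe []
    refine ⟨this, fun _ => ?_⟩
    rw [List.take_zero, ← pathElt_zero (e :: p)]
    exact Cong.refl this
  | succ j =>
    have h1 : G.pathElt k p (j + 1) ∈ G.degLt k (j + 1) (fallingSum (n + 1) (j + 1)) :=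
      degLe_le_degLt (fallingSum_lt n j) (hp (j + 1)).1
    have he' : G.word k [e] ∈ G.degLe k 1 (n + 1) := by
      have := word_mem_degLe (G := G) (k := k) [e]
      simpa [weight, he] using this
    have h2 : G.word k [e] * G.pathElt k p j ∈ G.degLe k (j + 1) (fallingSum (n + 1) (j + 1)) := by
      rw [fallingSum_succ, add_comm j 1]
      exact mul_mem_degLe he' (hp j).1
    have h3 : G.pathElt k (e :: p) (j + 1) ∈
        G.degLe k (j + 1) (fallingSum (n + 1) (j + 1)) := by
      rw [pathElt_cons_succ]
      exact add_mem (degLt_le_degLe h1) h2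
    refine ⟨h3, fun hj => ?_⟩
    have h4 := (Cong.refl he').mul ((hp j).2 (by simpa using hj))
    rw [← fallingSum_succ, add_comm 1 j, ← word_append] at h4
    refine Cong.trans ⟨h3, h4.left, ?_⟩ h4
    rw [pathElt_cons_succ, add_sub_cancel_right]
    exact h1

/-- The membership is needed also for j beyond the length of the path, because the error term e(p,
j+1) in the induction may exceed it. -/
theorem IsPath.pathElt_mem_and_cong {v w : V} {p : List E} (hp : G.IsPath v w p) (j : ℕ) :
    G.pathElt k p j ∈ G.degLe k j (fallingSum (G.level v) j) ∧
      (j ≤ p.length →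
        G.Cong k j (fallingSum (G.level v) j) (G.pathElt k p j) (G.word k (p.take j))) := by
  induction hp generalizing j with
  | single e =>
    rw [G.level_tail]
    refine cong_pathElt_cons (G.level_tail e) (fun j => ?_) j
    cases j with
    | zero =>
      have : G.pathElt k [] 0 ∈ G.degLe k 0 (fallingSum (G.level (G.head e)) 0) := by
        rw [pathElt_zero, fallingSum_zero]
        exact word_mem_degLe []
      refine ⟨this, fun _ => ?_⟩
      rw [List.take_zero, ← pathElt_zero []]
      exact Cong.refl this
    | succ j =>
      refine ⟨?_, fun h => (Nat.not_succ_le_zero _ h).elim⟩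
      rw [pathElt_nil_succ]
      exact zero_mem _
  | cons e hp ih =>
    rw [G.level_tail]
    exact cong_pathElt_cons (G.level_tail e) ih j

theorem IsPath.cong_pathElt {v w : V} {p : List E} (hp : G.IsPath v w p) {j : ℕ}
    (hj : j ≤ p.length) :
    G.Cong k j (fallingSum (G.level v) j) (G.pathElt k p j) (G.word k (p.take j)) :=
  (hp.pathElt_mem_and_cong j).2 hj

variable (G) in
/-- The degree of a word in the letters `(v, j)`. -/
def deg (_ : LayeredGraph V E) (s : List (V × ℕ)) : ℕ := (s.map Prod.snd).sum

variable (G) in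
/-- The weight of a word in the letters `(v, j)`. -/
def wt (s : List (V × ℕ)) : ℕ := (s.map fun x => fallingSum (G.level x.1) x.2).sum

variable (D : G.DistinguishedEdges)

theorem cong_elt {x : V × ℕ} (h1 : 1 ≤ x.2) (h2 : x.2 ≤ G.level x.1) {p : List E}
    (hp : G.IsPath x.1 G.star p) :
    G.Cong k x.2 (fallingSum (G.level x.1) x.2) (D.elt k x) (G.word k (p.take x.2)) := by
  have hstar := (G.level_eq_zero_iff G.star).2 rfl
  have hl : p.length = G.level x.1 := by rw [hp.level_eq, hstar, zero_add]
  have hD := D.isPath (ne_star_of_level h1 h2)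
  rw [DistinguishedEdges.elt, hD.pathElt_eq k hp h1 (by have := hD.level_eq; omega)]
  exact hp.cong_pathElt (by omega)

/-- Take a path q from v to w followed by the distinguished path from w. As q has length j, the
leading words of the two factors concatenate to the first j + m edges of this path. -/
theorem cong_elt_mul_elt {v w : V} {j m : ℕ} (hc : G.Covers (v, j) (w, m)) (h1 : 1 ≤ j)
    (h2 : 1 ≤ m) (h3 : m ≤ G.level w) :
    G.Cong k (j + m) (fallingSum (G.level v) j + fallingSum (G.level w) m)
      (D.elt k (v, j) * D.elt k (w, m)) (D.elt k (v, j + m)) := by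
  obtain ⟨⟨q, hq⟩, hl⟩ := hc
  simp only at hq hl
  have hw := D.isPath (ne_star_of_level h2 h3)
  have hqw := hq.append G hw
  have hql : q.length = j := by have := hq.level_eq; omega
  have c1 := cong_elt (k := k) D (x := (v, j)) h1 (by simp only; omega) hqw
  have c2 := cong_elt (k := k) D (x := (w, m)) h2 h3 hw
  have c3 := cong_elt (k := k) D (x := (v, j + m)) (by simp only; omega) (by simp only; omega) hqw
  have c := c1.mul c2
  simp only at c c3
  rw [fallingSum_add, show G.level v - j = G.level w by omega] at c3
  rw [← word_append, ← hql, List.take_left'  rfl] at c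
  rw [← hql, List.take_length_add_append] at c3
  rw [hql] at c c3
  exact c.trans c3.symm

theorem covers_mul_bounds {v w : V} {j m : ℕ} (hc : G.Covers (v, j) (w, m))
    (h3 : m ≤ G.level w) : j + m ≤ G.level v := by
  have := hc.2
  simp only at this
  omega

theorem mon_mem {s : List (V × ℕ)} (hs : G.IsLetterWord s) :
    D.mon k s ∈ G.degLe k (G.deg s) (G.wt s) := by
  induction s with
  | nil =>
    simpa [DistinguishedEdges.mon, deg, wt, word, weight] using
      word_mem_degLe (G := G) (k := k) []
  | cons x s ih =>
    obtain ⟨h1, h2⟩ := hs x List.mem_cons_self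
    have h := (cong_elt (k := k) D h1 h2 (D.isPath (ne_star_of_level h1 h2))).left
    have := mul_mem_degLe h (ih fun y hy => hs y (List.mem_cons_of_mem _ hy))
    simpa [DistinguishedEdges.mon, deg, wt] using this

theorem exists_eq_append_of_not_isChain {α : Type*} {R : α → α → Prop} {s : List α}
    (h : ¬ s.IsChain R) : ∃ a x y b, s = a ++ x :: y :: b ∧ ¬ R x y := by
  induction s with
  | nil => exact (h .nil).elim
  | cons x s ih =>
    cases s with
    | nil => exact (h (.singleton x)).elim
    | cons y s =>
      by_cases hxy : R x y
      · obtain ⟨a, x', y', b, e, h'⟩ := ih fun hs => h (List.isChain_cons_cons.2 ⟨hxy, hs⟩)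
        exact ⟨x :: a, x', y', b, by rw [e, List.cons_append], h'⟩
      · exact ⟨[], x, y, s, rfl, hxy⟩

/-- Every word can be made normal by merging letters with letters that they cover. -/
theorem exists_isNormal {P : List (V × ℕ) → Prop}
    (hP : ∀ a v j w m b, G.Covers (v, j) (w, m) → G.IsLetterWord (a ++ (v, j) :: (w, m) :: b) →
      P (a ++ (v, j) :: (w, m) :: b) → P (a ++ (v, j + m) :: b))
    {s : List (V × ℕ)} (hs : G.IsLetterWord s) (h : P s) : ∃ t, G.IsNormal t ∧ P t := by
  induction hl : s.length using Nat.strong_induction_on generalizing s with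
  | _ l ih =>
  by_cases hc : s.IsChain fun x y => ¬ G.Covers x y
  · exact ⟨s, ⟨hs, hc⟩, h⟩
  · obtain ⟨a, ⟨v, j⟩, ⟨w, m⟩, b, rfl, hvw⟩ := exists_eq_append_of_not_isChain hc
    replace hc := not_not.1 hvw
    refine ih _ ?_ ?_ (hP a v j w m b hc hs h) rfl
    · simp at hl ⊢
      omega
    · intro x hx
      rw [List.mem_append, List.mem_cons] at hx
      rcases hx with hx | rfl | hx
      · exact hs x (by simp [hx])
      · have h1 := hs (v, j) (by simp)
        have h2 := hs (w, m) (by simp)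
        exact ⟨h1.1.trans (Nat.le_add_right _ _), covers_mul_bounds hc h2.2⟩
      · exact hs x (by simp [hx])

theorem deg_merge (a b : List (V × ℕ)) (v w : V) (j m : ℕ) :
    G.deg (a ++ (v, j) :: (w, m) :: b) = G.deg (a ++ (v, j + m) :: b) := by
  simp [deg]; ring

theorem wt_merge (a b : List (V × ℕ)) {v w : V} {j m : ℕ} (hc : G.Covers (v, j) (w, m)) :
    G.wt (a ++ (v, j) :: (w, m) :: b) = G.wt (a ++ (v, j + m) :: b) := by
  have := hc.2
  simp only at this
  simp only [wt, List.map_append, List.map_cons, List.sum_append, List.sum_cons, fallingSum_add]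
  rw [show G.level v - j = G.level w by omega]
  ring

theorem cong_mon_merge (a b : List (V × ℕ)) {v w : V} {j m : ℕ} (hc : G.Covers (v, j) (w, m))
    (hs : G.IsLetterWord (a ++ (v, j) :: (w, m) :: b)) :
    G.Cong k (G.deg (a ++ (v, j) :: (w, m) :: b)) (G.wt (a ++ (v, j) :: (w, m) :: b))
      (D.mon k (a ++ (v, j) :: (w, m) :: b)) (D.mon k (a ++ (v, j + m) :: b)) := by
  have h1 := hs (v, j) (by simp)
  have h2 := hs (w, m) (by simp)
  have c := (Cong.refl (mon_mem (k := k) D (s := a) fun x hx => hs x (by simp [hx]))).mul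
    ((cong_elt_mul_elt (k := k) D hc h1.1 h2.1 h2.2).mul
      (Cong.refl (mon_mem (k := k) D (s := b) fun x hx => hs x (by simp [hx]))))
  have e1 : G.deg (a ++ (v, j) :: (w, m) :: b) = G.deg a + (j + m + G.deg b) := by
    simp [deg]; ring
  have e2 : G.wt (a ++ (v, j) :: (w, m) :: b) =
      G.wt a + (fallingSum (G.level v) j + fallingSum (G.level w) m + G.wt b) := by
    simp [wt]; ring
  rw [e1, e2]
  simpa [DistinguishedEdges.mon, mul_assoc] using c

theorem gt_star (v : V) (hv : v ≠ G.star) : G.Gt v G.star := by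
  induction hn : G.level v using Nat.strong_induction_on generalizing v with
  | _ n ih =>
  obtain ⟨e, rfl⟩ := G.exists_edge v hv
  by_cases h : G.head e = G.star
  · rw [← h]; exact G.gt_edge e
  · have := G.level_tail e
    exact (G.gt_edge e).trans (ih _ (by omega) _ h rfl)

theorem exists_path_cons_star (e : E) : ∃ p, G.IsPath (G.tail e) G.star (e :: p) := by
  by_cases h : G.head e = G.star
  · exact ⟨[], by rw [← h]; exact IsPath.single e⟩
  · obtain ⟨p, hp⟩ := gt_star _ h
    exact ⟨p, IsPath.cons e hp⟩

/-- The word in the letters `(v, 1)` given by the tails of the edges of a word. -/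
def letters (l : List E) : List (V × ℕ) := l.map fun e => (G.tail e, 1)

theorem isLetterWord_letters (l : List E) : G.IsLetterWord (letters (G := G) l) := by
  intro x hx
  obtain ⟨e, -, rfl⟩ := List.mem_map.1 hx
  exact ⟨le_rfl, by rw [G.level_tail]; exact Nat.le_add_left _ _⟩

/-- Every edge e begins some path to *, so e is the leading term of e(t(e), 1). -/
theorem cong_mon_letters (l : List E) : G.deg (letters (G := G) l) = l.length ∧
    G.wt (letters (G := G) l) = G.weight l ∧
    G.Cong k l.length (G.weight l) (D.mon k (letters (G := G) l)) (G.word k l) := by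
  induction l with
  | nil =>
    refine ⟨rfl, rfl, ?_⟩
    have e : D.mon k (letters (G := G) []) = G.word k [] := by
      simp [letters, DistinguishedEdges.mon, word]
    rw [e]
    exact Cong.refl (word_mem_degLe [])
  | cons e l ih =>
    obtain ⟨h1, h2, h3⟩ := ih
    have h0 := isLetterWord_letters (G := G) (e :: l) _ List.mem_cons_self
    obtain ⟨p, hp⟩ := exists_path_cons_star (G := G) e
    have c := (cong_elt (k := k) D h0.1 h0.2 hp).mul h3
    have e1 : G.weight (e :: l) = fallingSum (G.level (G.tail e)) 1 + G.weight l := by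
      simp [weight, fallingSum_one, edgeLevel]
    have e2 : (e :: l).length = 1 + l.length := by simp [add_comm]
    refine ⟨?_, ?_, ?_⟩
    · rw [e2, ← h1]; rfl
    · rw [e1, ← h2]; rfl
    · rw [e1, e2]
      have e3 : G.word k (e :: l) = G.word k [e] * G.word k l := by
        rw [← word_append]; rfl
      rw [e3]
      exact c

/-- The span of the normal monomials of degree `d` and weight at most `i`. -/
noncomputable def DistinguishedEdges.monLe (k : Type*) [Field k] (d i : ℕ) :
    Submodule k (G.Alg k) :=
  Submodule.span k {x | ∃ s, (G.IsNormal s ∧ G.deg s = d ∧ G.wt s ≤ i) ∧ x = D.mon k s}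

/-- A word of edges is congruent to the product of the letters (t(e), 1), and then, after merging,
to a normal monomial of the same degree and weight. The difference is a combination of words of the
same length and smaller weight, to which induction applies. -/
theorem degLe_le_monLe (d i : ℕ) : G.degLe k d i ≤ D.monLe k d i := by
  induction i using Nat.strong_induction_on with
  | _ i ih =>
  have hmono : ∀ j ≤ i, D.monLe k d j ≤ D.monLe k d i := fun j hj =>
    Submodule.span_mono (by
      rintro x ⟨s, ⟨h1, h2, h3⟩, rfl⟩; exact ⟨s, ⟨h1, h2, h3.trans hj⟩, rfl⟩)
  refine Submodule.span_le.2 ?_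
  rintro _ ⟨l, ⟨rfl, hl⟩, rfl⟩
  rcases hl.lt_or_eq with hl | rfl
  · exact hmono _ hl.le (ih _ hl (word_mem_degLe l))
  have hlt : G.degLt k l.length (G.weight l) ≤ D.monLe k l.length (G.weight l) := by
    refine Submodule.span_le.2 ?_
    rintro _ ⟨l', ⟨h1, h2⟩, rfl⟩
    refine hmono _ h2.le (ih _ h2 ?_)
    rw [← h1]
    exact word_mem_degLe l'
  obtain ⟨t, ht, h1, h2, h3⟩ := exists_isNormal (G := G)
    (P := fun s => G.deg s = l.length ∧ G.wt s = G.weight l ∧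
      G.Cong k l.length (G.weight l) (D.mon k s) (G.word k l))
    (fun a v j w m b hc hs ⟨h1, h2, h3⟩ => by
      have c := cong_mon_merge (k := k) D a b hc hs
      rw [h1, h2] at c
      exact ⟨(deg_merge a b v w j m).symm.trans h1, (wt_merge a b hc).symm.trans h2,
        c.symm.trans h3⟩)
    (isLetterWord_letters l) (cong_mon_letters (k := k) D l)
  rw [← sub_sub_cancel (D.mon k t) (G.word k l)]
  exact sub_mem (Submodule.subset_span ⟨t, ⟨ht, h1, h2.le⟩, rfl⟩) (hlt h3.sub)

end Spanning

end LayeredGraph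

/-! ### Bases adapted to a filtration and the associated graded algebra -/

namespace AlgFiltration

variable {k A ι : Type*} [Field k] [Ring A] [Algebra k A] (F : AlgFiltration k A)

theorem grClass_congr {i j : ℕ} {a b : A} (hij : i = j) (hab : a = b) (ha : a ∈ F.piece i)
    (hb : b ∈ F.piece j) : F.grClass i a ha = F.grClass j b hb := by
  subst hij; subst hab; rfl

theorem grClass_add {i : ℕ} {a b : A} (ha : a ∈ F.piece i) (hb : b ∈ F.piece i) :
    F.grClass i (a + b) (add_mem ha hb) = F.grClass i a ha + F.grClass i b hb :=
  map_add (DirectSum.of F.Component i) (F.cls i a ha) (F.cls i b hb)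

theorem grClass_smul {i : ℕ} {a : A} (c : k) (ha : a ∈ F.piece i) :
    F.grClass i (c • a) (Submodule.smul_mem _ c ha) = c • F.grClass i a ha :=
  (DirectSum.lof k ℕ F.Component i).map_smul c (F.cls i a ha)

theorem grClass_eq {i : ℕ} {a b : A} (ha : a ∈ F.piece i) (hb : b ∈ F.piece i)
    (h : a - b ∈ F.below i) : F.grClass i a ha = F.grClass i b hb :=
  congrArg (DirectSum.of F.Component i) ((Submodule.Quotient.eq _).2 h)

theorem grClass_eq_zero {i : ℕ} {a : A} (ha : a ∈ F.piece i) (h : a ∈ F.below i) :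
    F.grClass i a ha = 0 := by
  rw [F.grClass_eq ha (zero_mem _) (by rwa [sub_zero])]
  exact map_zero (DirectSum.of F.Component i)

theorem grClass_mul {i j : ℕ} {a b : A} (ha : a ∈ F.piece i) (hb : b ∈ F.piece j) :
    F.grClass i a ha * F.grClass j b hb = F.grClass (i + j) (a * b) (F.mul_mem ha hb) :=
  DirectSum.of_mul_of (F.cls i a ha) (F.cls j b hb)

theorem grClass_one : F.grClass 0 1 F.one_mem = 1 := rfl

/-- A basis of `A` that is adapted to the filtration: `A_(i)` is spanned by the basis vectors of
weight at most `i`. -/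
structure IsAdapted (b : Module.Basis ι k A) (w : ι → ℕ) : Prop where
  piece_eq : ∀ i, F.piece i = Submodule.span k (b '' {s | w s ≤ i})

variable {F} {b : Module.Basis ι k A} {w : ι → ℕ} (h : F.IsAdapted b w)

include h

theorem IsAdapted.mem_piece {s : ι} {i : ℕ} (hs : w s ≤ i) : b s ∈ F.piece i := by
  rw [h.piece_eq]
  exact Submodule.subset_span ⟨s, hs, rfl⟩

theorem IsAdapted.mem_below {s : ι} {i : ℕ} (hs : w s < i) : b s ∈ F.below i := by
  cases i with
  | zero => exact (Nat.not_lt_zero _ hs).elim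
  | succ i => exact h.mem_piece (Nat.lt_succ_iff.1 hs)

theorem IsAdapted.lt_of_mem_below {i : ℕ} {a : A} (ha : a ∈ F.below i) {s : ι}
    (hs : b.repr a s ≠ 0) : w s < i := by
  cases i with
  | zero =>
    have : a = 0 := by simpa [below] using ha
    simp [this] at hs
  | succ i =>
    have ha : a ∈ F.piece i := ha
    rw [h.piece_eq, Module.Basis.mem_span_image] at ha
    exact Nat.lt_succ_iff.2 (ha (Finsupp.mem_support_iff.2 hs))

/-- The basis vector of `gr A` induced by an adapted basis. -/
noncomputable def IsAdapted.grVec (s : ι) : F.Gr := F.grClass (w s) (b s) (h.mem_piece le_rfl)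

open Classical in
/-- The coordinates of the elements of `A_(i) / A_(i-1)`. -/
noncomputable def IsAdapted.componentCoord (i : ℕ) : F.Component i →ₗ[k] (ι →₀ k) :=
  Submodule.liftQ ((F.below i).comap (F.piece i).subtype)
    ((Finsupp.supported k k {s | w s = i}).subtype ∘ₗ Finsupp.restrictDom k k {s | w s = i} ∘ₗ
      b.repr.toLinearMap ∘ₗ (F.piece i).subtype) (by
    intro a ha
    have ha' : a.1 ∈ F.below i := ha
    rw [LinearMap.mem_ker]
    ext s
    by_cases hs : w s = i
    · by_contra hne
      have := h.lt_of_mem_below (s := s) ha' (by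
        simpa [Finsupp.restrictDom_apply, Finsupp.filter_apply, hs] using hne)
      omega
    · simp [Finsupp.restrictDom_apply, hs])

/-- The coordinates of the elements of `gr A`. -/
noncomputable def IsAdapted.grCoord : F.Gr →ₗ[k] (ι →₀ k) :=
  DirectSum.toModule k ℕ _ h.componentCoord

open Classical in
theorem IsAdapted.grCoord_grVec (s : ι) : h.grCoord (h.grVec s) = Finsupp.single s 1 := by
  have e : h.grCoord (h.grVec s) =
      Finsupp.filter (fun t => t ∈ {t | w t = w s}) (b.repr (b s)) :=
    DirectSum.toModule_lof k (w s) (F.cls (w s) (b s) (h.mem_piece le_rfl))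
  rw [e, b.repr_self]
  exact Finsupp.filter_single_of_pos _ rfl

theorem IsAdapted.linearIndependent_grVec : LinearIndependent k h.grVec := by
  refine LinearIndependent.of_comp h.grCoord ?_
  have e : h.grCoord ∘ h.grVec = fun s => Finsupp.single s 1 := funext h.grCoord_grVec
  rw [e]
  exact Finsupp.linearIndependent_single_one k ι

/-- Such an element is a combination of basis vectors that are in T and have weight at most i. Those
of weight less than i vanish in the quotient, and those of weight i give their own classes. -/
theorem IsAdapted.grClass_mem {T : Set ι} {i : ℕ} {a : A} (ha : a ∈ F.piece i)
    (haT : a ∈ Submodule.span k (b '' T)) :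
    F.grClass i a ha ∈ Submodule.span k (h.grVec '' T) := by
  have hmem : a ∈ Submodule.span k (b '' (T ∩ {s | w s ≤ i})) := by
    rw [Module.Basis.mem_span_image, Set.subset_inter_iff]
    rw [h.piece_eq] at ha
    exact ⟨b.mem_span_image.1 haT, b.mem_span_image.1 ha⟩
  have hle : ∀ x ∈ Submodule.span k (b '' (T ∩ {s | w s ≤ i})), x ∈ F.piece i := by
    intro x hx
    rw [h.piece_eq]
    exact Submodule.span_mono (Set.image_mono Set.inter_subset_right) hx
  clear haT
  revert ha
  induction hmem using Submodule.span_induction with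
  | mem x hx =>
    intro ha
    obtain ⟨s, ⟨hsT, hs⟩, rfl⟩ := hx
    rcases (show w s ≤ i from hs).lt_or_eq with hs | rfl
    · rw [F.grClass_eq_zero ha (h.mem_below hs)]
      exact zero_mem _
    · exact Submodule.subset_span ⟨s, hsT, rfl⟩
  | zero =>
    intro ha
    rw [F.grClass_eq_zero ha (zero_mem _)]
    exact zero_mem _
  | add x y hx hy ihx ihy =>
    intro _
    rw [F.grClass_add (hle x hx) (hle y hy)]
    exact add_mem (ihx _) (ihy _)
  | smul c x hx ihx =>
    intro _
    rw [F.grClass_smul c (hle x hx)]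
    exact Submodule.smul_mem _ c (ihx _)

theorem IsAdapted.span_grVec : ⊤ ≤ Submodule.span k (Set.range h.grVec) := by
  rintro x -
  induction x using DirectSum.induction_on with
  | zero => exact zero_mem _
  | of i x =>
    induction x using F.component_ind with
    | h a ha =>
      have := h.grClass_mem (T := Set.univ) ha (by rw [Set.image_univ, b.span_eq]; trivial)
      rwa [Set.image_univ] at this
  | add x y hx hy => exact add_mem hx hy

/-- The basis of `gr A` induced by an adapted basis. -/
noncomputable def IsAdapted.grBasis : Module.Basis ι k F.Gr :=
  Module.Basis.mk h.linearIndependent_grVec h.span_grVec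

theorem IsAdapted.grBasis_apply (s : ι) :
    h.grBasis s = F.grClass (w s) (b s) (h.mem_piece le_rfl) :=
  Module.Basis.mk_apply _ _ s

theorem IsAdapted.grSubmodule_eq (T : Set ι) :
    F.grSubmodule (Submodule.span k (b '' T)) = Submodule.span k (h.grBasis '' T) := by
  have e : ⇑h.grBasis = h.grVec := funext h.grBasis_apply
  rw [e]
  refine le_antisymm (Submodule.span_le.2 ?_) (Submodule.span_le.2 ?_)
  · rintro _ ⟨i, a, ha, haT, rfl⟩
    exact h.grClass_mem ha haT
  · rintro _ ⟨s, hs, rfl⟩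
    exact Submodule.subset_span ⟨w s, b s, _, Submodule.subset_span ⟨s, hs, rfl⟩, rfl⟩

end AlgFiltration

/-! ### Dimensions and traces on spans of basis vectors -/

section Permutation

variable {k M ι : Type*} [Field k] [AddCommGroup M] [Module k M] (b : Module.Basis ι k M)

/-- A subset of a basis is a basis of its span. -/
noncomputable def basisOfSpanImage {T : Set ι} {p : Submodule k M}
    (hp : p = Submodule.span k (b '' T)) : Module.Basis T k p :=
  (Module.Basis.span (v := fun i : T => b i)
    (b.linearIndependent.comp _ Subtype.val_injective)).map
    (LinearEquiv.ofEq _ _ (by rw [hp, Set.image_eq_range]))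

theorem basisOfSpanImage_apply {T : Set ι} {p : Submodule k M}
    (hp : p = Submodule.span k (b '' T)) (i : T) : (basisOfSpanImage b hp i : M) = b i := by
  rw [basisOfSpanImage, Module.Basis.map_apply, LinearEquiv.coe_ofEq_apply,
    Module.Basis.span_apply]

theorem span_image_inf_span_image (S T : Set ι) :
    Submodule.span k (b '' S) ⊓ Submodule.span k (b '' T) = Submodule.span k (b '' (S ∩ T)) := by
  ext x
  simp only [Submodule.mem_inf, Module.Basis.mem_span_image, Set.subset_inter_iff]

theorem finrank_of_eq_span_image {T : Set ι} {p : Submodule k M}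
    (hp : p = Submodule.span k (b '' T)) : Module.finrank k p = T.ncard := by
  rw [Module.finrank_eq_nat_card_basis (basisOfSpanImage b hp)]
  rfl

theorem finite_of_eq_span_image {T : Set ι} (hT : T.Finite) {p : Submodule k M}
    (hp : p = Submodule.span k (b '' T)) : Module.Finite k p := by
  have := hT.to_subtype
  exact Module.Finite.of_basis (basisOfSpanImage b hp)

/-- The trace of a map permuting a basis is the number of fixed basis vectors. -/
theorem trace_restrict_of_basis {T : Set ι} (hT : T.Finite) {p : Submodule k M}
    (hp : p = Submodule.span k (b '' T)) {f : M →ₗ[k] M} (hf : ∀ x ∈ p, f x ∈ p) {τ : ι → ι}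
    (hτ : ∀ i, f (b i) = b (τ i)) (hτT : ∀ i ∈ T, τ i ∈ T) :
    LinearMap.trace k p (f.restrict hf) = ((T ∩ {i | τ i = i}).ncard : k) := by
  classical
  have := hT.fintype
  have key : ∀ i : T, f.restrict hf (basisOfSpanImage b hp i) =
      basisOfSpanImage b hp ⟨τ i, hτT i i.2⟩ := by
    intro i
    apply Subtype.ext
    rw [LinearMap.coe_restrict_apply, basisOfSpanImage_apply, basisOfSpanImage_apply, hτ]
  rw [LinearMap.trace_eq_matrix_trace k (basisOfSpanImage b hp), Matrix.trace]
  have : ∀ i : T, (LinearMap.toMatrix (basisOfSpanImage b hp) (basisOfSpanImage b hp)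
      (f.restrict hf)).diag i = if τ i = i then 1 else 0 := by
    intro i
    rw [Matrix.diag_apply, LinearMap.toMatrix_apply, key, Module.Basis.repr_self,
      Finsupp.single_apply]
    simp [Subtype.ext_iff]
  rw [Finset.sum_congr rfl fun i _ => this i, Finset.sum_boole]
  congr 1
  rw [← Set.ncard_coe_finset, ← Set.ncard_image_of_injective _ Subtype.val_injective]
  congr 1
  ext i
  simp [and_comm]

end Permutation

namespace LayeredGraph

/-! ### The bases of normal monomials -/

section Bases

variable {V E : Type*} {G : LayeredGraph V E} (D : G.DistinguishedEdges) (k : Type*) [Field k]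

theorem range_mon_span [Finite V] :
    ⊤ ≤ Submodule.span k (Set.range fun s : {s // G.IsNormal s} => D.mon k s.1) := by
  have hword : ∀ a : G.Alg k,
      a ∈ Submodule.span k {x | ∃ l : List E, True ∧ x = G.word k l} := by
    intro a
    obtain ⟨x, rfl⟩ := RingQuot.mkAlgHom_surjective k (G.Rel k) a
    induction x using FreeAlgebra.induction with
    | grade0 r =>
      rw [AlgHom.commutes, Algebra.algebraMap_eq_smul_one]
      exact Submodule.smul_mem _ _ (Submodule.subset_span ⟨[], trivial, by simp [word]⟩)
    | grade1 e => exact Submodule.subset_span ⟨[e], trivial, by simp [word]⟩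
    | mul a b ha hb =>
      rw [map_mul]
      exact mul_mem_span_word (fun _ _ _ _ => trivial) ha hb
    | add a b ha hb => rw [map_add]; exact add_mem ha hb
  rintro a -
  refine (Submodule.span_le.2 ?_ : _ ≤ Submodule.span k _) (hword a)
  rintro _ ⟨l, -, rfl⟩
  have := degLe_le_monLe D _ _ (word_mem_degLe (k := k) l)
  refine Submodule.span_mono ?_ this
  rintro _ ⟨s, ⟨hs, -⟩, rfl⟩
  exact ⟨⟨s, hs⟩, rfl⟩

/-- The basis of `A(Γ)` consisting of the normal monomials. -/
noncomputable def DistinguishedEdges.basis [Finite V] :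
    Module.Basis {s // G.IsNormal s} k (G.Alg k) :=
  Module.Basis.mk (linearIndependent_mon k D) (range_mon_span D k)

variable [Finite V]

theorem basis_apply (s : {s // G.IsNormal s}) : D.basis k s = D.mon k s.1 :=
  Module.Basis.mk_apply _ _ s

/-- The spanning argument never raises the weight, and conversely a monomial lies in the piece given
by its own weight. -/
theorem isAdapted_basis :
    (G.filtration k).IsAdapted (D.basis k) (fun s => G.wt s.1) := by
  refine ⟨fun i => le_antisymm (Submodule.span_le.2 ?_) (Submodule.span_le.2 ?_)⟩
  · rintro _ ⟨l, hl, rfl⟩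
    refine Submodule.span_mono ?_
      (degLe_le_monLe D _ _ (degLe_mono hl (word_mem_degLe (k := k) l)))
    rintro _ ⟨s, ⟨hs, -, hi⟩, rfl⟩
    exact ⟨⟨s, hs⟩, hi, basis_apply D k _⟩
  · rintro _ ⟨s, hs, rfl⟩
    rw [basis_apply]
    refine Submodule.span_mono ?_ (degLe_mono hs (mon_mem (k := k) D s.2.1))
    rintro _ ⟨l, ⟨-, hl⟩, rfl⟩
    exact ⟨l, hl, rfl⟩

theorem degreePart_eq_span (d : ℕ) :
    G.degreePart k d = Submodule.span k (D.basis k '' {s | G.deg s.1 = d}) := by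
  refine le_antisymm (Submodule.span_le.2 ?_) (Submodule.span_le.2 ?_)
  · rintro _ ⟨l, rfl, rfl⟩
    refine Submodule.span_mono ?_ (degLe_le_monLe D _ _ (word_mem_degLe (k := k) l))
    rintro _ ⟨s, ⟨hs, hd, -⟩, rfl⟩
    exact ⟨⟨s, hs⟩, hd, basis_apply D k _⟩
  · rintro _ ⟨s, rfl, rfl⟩
    rw [basis_apply]
    refine Submodule.span_mono ?_ (mon_mem (k := k) D s.2.1)
    rintro _ ⟨l, ⟨hl, -⟩, rfl⟩
    exact ⟨l, hl, rfl⟩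

/-- The basis of `gr A(Γ)` consisting of the classes of the normal monomials. -/
noncomputable def DistinguishedEdges.grBasis :
    Module.Basis {s // G.IsNormal s} k (G.GrAlg k) :=
  (isAdapted_basis D k).grBasis

theorem grDegreePart_eq_span (d : ℕ) :
    G.grDegreePart k d = Submodule.span k (D.grBasis k '' {s | G.deg s.1 = d}) := by
  rw [grDegreePart, degreePart_eq_span D]
  exact (isAdapted_basis D k).grSubmodule_eq _

end Bases

/-! ### Products of the elements e(v,j) in the associated graded algebra -/

section GrMon

variable {V E : Type*} {G : LayeredGraph V E} (D : G.DistinguishedEdges) (k : Type*) [Field k]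

theorem degLe_le_piece {d i : ℕ} : G.degLe k d i ≤ (G.filtration k).piece i :=
  Submodule.span_mono (by rintro _ ⟨l, ⟨-, hl⟩, rfl⟩; exact ⟨l, hl, rfl⟩)

theorem degLt_le_below {d i : ℕ} : G.degLt k d i ≤ (G.filtration k).below i := by
  refine Submodule.span_le.2 ?_
  rintro _ ⟨l, ⟨-, hl⟩, rfl⟩
  cases i with
  | zero => exact (Nat.not_lt_zero _ hl).elim
  | succ i => exact Submodule.subset_span ⟨l, Nat.lt_succ_iff.1 hl, rfl⟩

variable {k} in
theorem Cong.grClass_eq {d i : ℕ} {a b : G.Alg k} (h : G.Cong k d i a b) :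
    (G.filtration k).grClass i a (degLe_le_piece k h.left) =
      (G.filtration k).grClass i b (degLe_le_piece k h.right) :=
  (G.filtration k).grClass_eq _ _ (degLt_le_below k h.sub)

/-- The product of the elements `e(v_i, j_i)` of `gr A(Γ)`. -/
noncomputable def DistinguishedEdges.grMon (s : List (V × ℕ)) : G.GrAlg k :=
  (s.map fun y => grElement k D y.1 y.2).prod

theorem grMon_append (s t : List (V × ℕ)) :
    D.grMon k (s ++ t) = D.grMon k s * D.grMon k t := by
  simp [DistinguishedEdges.grMon]

/-- The left side is the class of a word in the edges, while `elt` also has terms of lower weight,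
which vanish in the graded algebra. The filtration degrees match because the first j edges of a path
from v have levels |v|, |v| - 1, …. -/
theorem grElement_eq {x : V × ℕ} (h1 : 1 ≤ x.2) (h2 : x.2 ≤ G.level x.1) :
    ∃ h, grElement k D x.1 x.2 =
      (G.filtration k).grClass (fallingSum (G.level x.1) x.2) (D.elt k x) h := by
  have c := cong_elt (k := k) D h1 h2 (D.isPath (ne_star_of_level h1 h2))
  refine ⟨degLe_le_piece k c.left, ?_⟩
  rw [c.grClass_eq]
  have hw : ∀ {v w : V} {p : List E}, G.IsPath v w p → ∀ j ≤ p.length,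
      G.weight (p.take j) = fallingSum (G.level v) j := by
    intro v w p hp
    induction hp with
    | single e =>
      intro j hj
      rw [List.length_singleton] at hj
      interval_cases j
      · simp [weight, fallingSum]
      · simp [weight, fallingSum, edgeLevel]
    | cons e hp ih =>
      intro j hj
      cases j with
      | zero => simp [weight, fallingSum]
      | succ j =>
        have := ih j (by simpa using hj)
        rw [G.level_tail, fallingSum_succ, ← this, ← G.level_tail]
        simp [weight, edgeLevel]
  have hp := D.isPath (ne_star_of_level h1 h2)
  have := hp.level_eq
  rw [(G.level_eq_zero_iff G.star).2 rfl] at this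
  exact (G.filtration k).grClass_congr (hw hp _ (by omega)) rfl _ _

theorem grMon_eq {s : List (V × ℕ)} (hs : G.IsLetterWord s) : D.grMon k s =
    (G.filtration k).grClass (G.wt s) (D.mon k s) (degLe_le_piece k (mon_mem D hs)) := by
  induction s with
  | nil => exact ((G.filtration k).grClass_one).symm
  | cons x s ih =>
    obtain ⟨h1, h2⟩ := hs x List.mem_cons_self
    obtain ⟨h, hx⟩ := grElement_eq D k h1 h2
    have hs' : G.IsLetterWord s := fun y hy => hs y (List.mem_cons_of_mem _ hy)
    have e : D.grMon k (x :: s) = grElement k D x.1 x.2 * D.grMon k s := by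
      simp [DistinguishedEdges.grMon]
    rw [e, hx, ih hs', AlgFiltration.grClass_mul]
    exact (G.filtration k).grClass_congr (by simp [wt]) (by simp [DistinguishedEdges.mon]) _ _

theorem grBasis_apply [Finite V] (s : {s // G.IsNormal s}) : D.grBasis k s = D.grMon k s.1 := by
  rw [grMon_eq D k s.2.1, DistinguishedEdges.grBasis, AlgFiltration.IsAdapted.grBasis_apply]
  exact (G.filtration k).grClass_congr rfl (basis_apply D k s) _ _

theorem grMon_merge (a b : List (V × ℕ)) {v w : V} {j m : ℕ} (hc : G.Covers (v, j) (w, m))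
    (hs : G.IsLetterWord (a ++ (v, j) :: (w, m) :: b)) :
    D.grMon k (a ++ (v, j) :: (w, m) :: b) = D.grMon k (a ++ (v, j + m) :: b) := by
  have hs' : G.IsLetterWord (a ++ (v, j + m) :: b) := by
    intro x hx
    rw [List.mem_append, List.mem_cons] at hx
    rcases hx with hx | rfl | hx
    · exact hs x (by simp [hx])
    · have h1 := hs (v, j) (by simp)
      have h2 := hs (w, m) (by simp)
      exact ⟨h1.1.trans (Nat.le_add_right _ _), covers_mul_bounds hc h2.2⟩
    · exact hs x (by simp [hx])
  rw [grMon_eq D k hs, grMon_eq D k hs', (cong_mon_merge (k := k) D a b hc hs).grClass_eq]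
  exact (G.filtration k).grClass_congr (wt_merge a b hc) rfl _ _

end GrMon

/-! ### The permutation of normal words by σ, traces, and the fixed subalgebra -/

section Action

variable {V E : Type*} {G : LayeredGraph V E} (σ : G.Aut) (D : G.DistinguishedEdges)
  (k : Type*) [Field k]

/-- The inverse of a level-preserving automorphism. -/
def Aut.inv : G.Aut where
  onV := σ.onV.symm
  onE := σ.onE.symm
  tail_onE e := by rw [Equiv.eq_symm_apply, ← σ.tail_onE, Equiv.apply_symm_apply]
  head_onE e := by rw [Equiv.eq_symm_apply, ← σ.head_onE, Equiv.apply_symm_apply]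
  level_onV v := by rw [← σ.level_onV, Equiv.apply_symm_apply]

theorem Aut.gt_map {v w : V} (h : G.Gt v w) : G.Gt (σ.onV v) (σ.onV w) := by
  obtain ⟨p, hp⟩ := h
  exact ⟨_, σ.isPath_map hp⟩

theorem Aut.gt_of_map {v w : V} (h : G.Gt (σ.onV v) (σ.onV w)) : G.Gt v w := by
  simpa [Aut.inv] using σ.inv.gt_map h

theorem Aut.onV_star : σ.onV G.star = G.star := by
  rw [← G.level_eq_zero_iff, σ.level_onV, G.level_eq_zero_iff]

/-- The action on words in the letters `(v, j)`. -/
def Aut.onLetters (s : List (V × ℕ)) : List (V × ℕ) := s.map fun x => (σ.onV x.1, x.2)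

theorem Aut.isLetterWord_onLetters {s : List (V × ℕ)} (hs : G.IsLetterWord s) :
    G.IsLetterWord (σ.onLetters s) := by
  intro x hx
  obtain ⟨y, hy, rfl⟩ := List.mem_map.1 hx
  simpa [σ.level_onV] using hs y hy

theorem Aut.isNormal_onLetters {s : List (V × ℕ)} (hs : G.IsNormal s) :
    G.IsNormal (σ.onLetters s) := by
  refine ⟨σ.isLetterWord_onLetters hs.1, ?_⟩
  rw [Aut.onLetters, List.isChain_map]
  refine hs.2.imp fun x y hxy hc => hxy ⟨σ.gt_of_map hc.1, ?_⟩
  simpa [σ.level_onV] using hc.2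

/-- The action on normal words. -/
def Aut.onNormal (s : {s // G.IsNormal s}) : {s // G.IsNormal s} :=
  ⟨σ.onLetters s.1, σ.isNormal_onLetters s.2⟩

theorem Aut.deg_onLetters (s : List (V × ℕ)) : G.deg (σ.onLetters s) = G.deg s := by
  simp [deg, Aut.onLetters, Function.comp_def]

theorem Aut.wt_onLetters (s : List (V × ℕ)) : G.wt (σ.onLetters s) = G.wt s := by
  simp [wt, Aut.onLetters, Function.comp_def, σ.level_onV]

theorem Aut.onNormal_eq_iff (s : {s // G.IsNormal s}) :
    σ.onNormal s = s ↔ ∀ x ∈ s.1, σ.onV x.1 = x.1 := by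
  rw [Subtype.ext_iff]
  change s.1.map (fun x => (σ.onV x.1, x.2)) = s.1 ↔ _
  conv_lhs => rhs; rw [← List.map_id s.1]
  rw [List.map_inj_left]
  exact forall₂_congr fun x _ => by simp [Prod.ext_iff]

theorem Aut.onAlg_pathElt (p : List E) (j : ℕ) :
    σ.onAlg k (G.pathElt k p j) = G.pathElt k (p.map σ.onE) j := by
  rw [pathElt, Aut.onAlg, RingQuot.liftAlgHom_mkAlgHom_apply, AlgHom.comp_apply,
    σ.onFree_pathElement]
  rfl

/-- The image of the distinguished path of v need not be distinguished, but it is a path from σv to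
*, and the relations give it the same elements. -/
theorem Aut.onAlg_elt {x : V × ℕ} (h1 : 1 ≤ x.2) (h2 : x.2 ≤ G.level x.1) :
    σ.onAlg k (D.elt k x) = D.elt k (σ.onV x.1, x.2) := by
  have hx := ne_star_of_level h1 h2
  have hp := σ.isPath_map (D.isPath hx)
  rw [σ.onV_star] at hp
  have hq := D.isPath (v := σ.onV x.1) (ne_star_of_level h1 (by rwa [σ.level_onV]))
  have hl := hp.level_eq
  rw [(G.level_eq_zero_iff G.star).2 rfl, σ.level_onV] at hl
  rw [DistinguishedEdges.elt, σ.onAlg_pathElt]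
  exact hp.pathElt_eq k hq h1 (by omega)

theorem Aut.onAlg_mon {s : List (V × ℕ)} (hs : G.IsLetterWord s) :
    σ.onAlg k (D.mon k s) = D.mon k (σ.onLetters s) := by
  rw [DistinguishedEdges.mon, map_list_prod, DistinguishedEdges.mon, Aut.onLetters, List.map_map,
    List.map_map]
  congr 1
  refine List.map_congr_left fun x hx => ?_
  exact σ.onAlg_elt D k (hs x hx).1 (hs x hx).2

theorem isFixedNormal_iff (s : List (V × ℕ)) :
    σ.IsFixedNormal s ↔ G.IsNormal s ∧ ∀ x ∈ s, σ.onV x.1 = x.1 := by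
  constructor
  · rintro ⟨h1, h2⟩
    exact ⟨⟨fun x hx => (h1 x hx).2.2, h2⟩, fun x hx => (h1 x hx).1⟩
  · rintro ⟨⟨h1, h2⟩, h3⟩
    exact ⟨fun x hx => ⟨h3 x hx, ne_star_of_level (h1 x hx).1 (h1 x hx).2, h1 x hx⟩, h2⟩

/-- Merging preserves the product in the graded algebra and keeps only vertices already present, so
the resulting normal word is still fixed by σ. -/
theorem grMon_mem_fixedPart {s : List (V × ℕ)} (hs : G.IsLetterWord s)
    (hσ : ∀ x ∈ s, σ.onV x.1 = x.1) : D.grMon k s ∈ σ.fixedPart k D := by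
  obtain ⟨t, ht, hσt, hst⟩ := exists_isNormal (G := G)
    (P := fun t => (∀ x ∈ t, σ.onV x.1 = x.1) ∧ D.grMon k s = D.grMon k t)
    (fun a v j w m b hc hl ⟨h1, h2⟩ => by
      refine ⟨fun x hx => ?_, h2.trans (grMon_merge D k a b hc hl)⟩
      rw [List.mem_append, List.mem_cons] at hx
      rcases hx with hx | rfl | hx
      · exact h1 x (by simp [hx])
      · exact h1 (v, j) (by simp)
      · exact h1 x (by simp [hx])) hs ⟨hσ, rfl⟩
  rw [hst]
  exact Submodule.subset_span ⟨t, (isFixedNormal_iff σ t).2 ⟨ht, hσt⟩, rfl⟩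

theorem mul_mem_fixedPart {a b : G.GrAlg k} (ha : a ∈ σ.fixedPart k D)
    (hb : b ∈ σ.fixedPart k D) : a * b ∈ σ.fixedPart k D := by
  have hab := Submodule.mul_mem_mul ha hb
  rw [Aut.fixedPart, Submodule.span_mul_span] at hab
  refine (Submodule.span_le.2 ?_ : _ ≤ σ.fixedPart k D) hab
  rintro _ ⟨_, ⟨s, hs, rfl⟩, _, ⟨t, ht, rfl⟩, rfl⟩
  rw [isFixedNormal_iff] at hs ht
  have := grMon_mem_fixedPart σ D k (s := s ++ t)
    (fun x hx => (List.mem_append.1 hx).elim (hs.1.1 x) (ht.1.1 x))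
    (fun x hx => (List.mem_append.1 hx).elim (hs.2 x) (ht.2 x))
  rw [grMon_append] at this
  exact this

theorem one_mem_fixedPart : 1 ∈ σ.fixedPart k D :=
  Submodule.subset_span ⟨[], ⟨by simp, .nil⟩, by simp⟩

/-- The number of normal words of degree `d` in letters fixed by `σ`. -/
noncomputable def Aut.fixedCount (d : ℕ) : ℕ :=
  {s : List (V × ℕ) | G.IsNormal s ∧ (∀ x ∈ s, σ.onV x.1 = x.1) ∧ G.deg s = d}.ncard

theorem Aut.fixedCount_eq (d : ℕ) : σ.fixedCount d =
    ({s : {s // G.IsNormal s} | G.deg s.1 = d} ∩ {s | σ.onNormal s = s}).ncard := by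
  rw [Aut.fixedCount, ← Set.ncard_image_of_injective _ Subtype.val_injective]
  congr 1
  ext s
  constructor
  · rintro ⟨h1, h2, h3⟩
    exact ⟨⟨s, h1⟩, ⟨h3, (σ.onNormal_eq_iff _).2 h2⟩, rfl⟩
  · rintro ⟨s, ⟨h3, h2⟩, rfl⟩
    exact ⟨s.2, (σ.onNormal_eq_iff _).1 h2, h3⟩

variable [Finite V]

theorem Aut.onAlg_basis (s : {s // G.IsNormal s}) :
    (σ.onAlg k).toLinearMap (D.basis k s) = D.basis k (σ.onNormal s) := by
  rw [basis_apply, basis_apply]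
  exact σ.onAlg_mon D k s.2.1

theorem Aut.onGr_grBasis (s : {s // G.IsNormal s}) :
    σ.onGr k (D.grBasis k s) = D.grBasis k (σ.onNormal s) := by
  rw [grBasis_apply, grBasis_apply, grMon_eq D k s.2.1, grMon_eq D k (σ.onNormal s).2.1,
    Aut.onGr, AlgFiltration.grMap_grClass]
  exact (G.filtration k).grClass_congr (σ.wt_onLetters s.1).symm (σ.onAlg_mon D k s.2.1) _ _

theorem fixedPart_eq_span : σ.fixedPart k D =
    Submodule.span k (D.grBasis k '' {s | σ.onNormal s = s}) := by
  rw [Aut.fixedPart]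
  congr 1
  ext x
  constructor
  · rintro ⟨s, hs, rfl⟩
    rw [isFixedNormal_iff] at hs
    exact ⟨⟨s, hs.1⟩, (σ.onNormal_eq_iff _).2 hs.2, grBasis_apply D k _⟩
  · rintro ⟨s, hs, rfl⟩
    exact ⟨s.1, (isFixedNormal_iff σ _).2 ⟨s.2, (σ.onNormal_eq_iff _).1 hs⟩, grBasis_apply D k _⟩

variable (G) in
-- Each letter has positive degree, so both the length of a word and the degree of each of its
-- letters are at most d.
theorem finite_deg_eq (d : ℕ) : {s : {s // G.IsNormal s} | G.deg s.1 = d}.Finite := by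
  have h := (List.finite_length_le (V × Fin (d + 1)) d).image
    (List.map fun x : V × Fin (d + 1) => (x.1, (x.2 : ℕ)))
  refine Set.Finite.of_finite_image (f := Subtype.val) (h.subset ?_) Subtype.val_injective.injOn
  rintro _ ⟨s, rfl, rfl⟩
  have h1 : s.1.length ≤ G.deg s.1 := by
    have := List.card_nsmul_le_sum (s.1.map Prod.snd) 1 (by
      intro j hj
      obtain ⟨x, hx, rfl⟩ := List.mem_map.1 hj
      exact (s.2.1 x hx).1)
    simpa [deg] using this
  have h2 : ∀ x ∈ s.1, x.2 ≤ G.deg s.1 := fun x hx =>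
    List.single_le_sum (fun _ _ => Nat.zero_le _) _ (List.mem_map_of_mem hx)
  refine ⟨s.1.map fun x => (x.1, Fin.ofNat _ x.2), by simpa using h1, ?_⟩
  rw [List.map_map]
  conv_rhs => rw [← List.map_id s.1]
  refine List.map_congr_left fun x hx => ?_
  have := h2 x hx
  simp [Nat.mod_eq_of_lt (Nat.lt_succ_of_le this)]

theorem finite_degreePart (D : G.DistinguishedEdges) (d : ℕ) : Module.Finite k (G.degreePart k d) :=
  finite_of_eq_span_image (D.basis k) (finite_deg_eq G d) (degreePart_eq_span D k d)

theorem finite_grDegreePart (D : G.DistinguishedEdges) (d : ℕ) :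
    Module.Finite k (G.grDegreePart k d) :=
  finite_of_eq_span_image (D.grBasis k) (finite_deg_eq G d) (grDegreePart_eq_span D k d)

/-- Both subspaces are spanned by subsets of one basis, so their intersection is spanned by the
common vectors. -/
theorem coeff_fixedHilbertSeries (d : ℕ) :
    PowerSeries.coeff d (σ.fixedHilbertSeries k D) = σ.fixedCount d := by
  rw [Aut.fixedHilbertSeries, PowerSeries.coeff_mk, Aut.fixedCount_eq]
  refine congrArg Nat.cast (finrank_of_eq_span_image (D.grBasis k) ?_)
  rw [fixedPart_eq_span, grDegreePart_eq_span D, span_image_inf_span_image, Set.inter_comm]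

theorem gradedTraceAlg_eq :
    σ.gradedTraceAlg k = PowerSeries.map (Int.castRingHom k) (σ.fixedHilbertSeries k D) := by
  ext d
  rw [PowerSeries.coeff_map, coeff_fixedHilbertSeries, Aut.gradedTraceAlg, PowerSeries.coeff_mk,
    trace_restrict_of_basis (D.basis k) (finite_deg_eq G d) (degreePart_eq_span D k d) _
      (σ.onAlg_basis D k) (fun s hs => (σ.deg_onLetters s.1).trans hs), Aut.fixedCount_eq]
  simp

theorem gradedTraceGr_eq :
    σ.gradedTraceGr k = PowerSeries.map (Int.castRingHom k) (σ.fixedHilbertSeries k D) := by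
  ext d
  rw [PowerSeries.coeff_map, coeff_fixedHilbertSeries, Aut.gradedTraceGr, PowerSeries.coeff_mk,
    trace_restrict_of_basis (D.grBasis k) (finite_deg_eq G d) (grDegreePart_eq_span D k d) _
      (σ.onGr_grBasis D k) (fun s hs => (σ.deg_onLetters s.1).trans hs), Aut.fixedCount_eq]
  simp

end Action

end LayeredGraph

namespace LayeredGraph

/-! ### Recursions for fixed normal words and for chains -/

section GeneratingFunction

open PowerSeries

variable {V E : Type*} (G : LayeredGraph V E)

/-- The generating function, by degree, of a set of words in the letters `(v, j)`. -/
noncomputable def genFun (S : Set (List (V × ℕ))) : PowerSeries ℤ :=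
  PowerSeries.mk fun d => (({s | s ∈ S ∧ G.deg s = d}.ncard : ℕ) : ℤ)

variable {G}

theorem finite_deg_fiber [Finite V] {S : Set (List (V × ℕ))} (hS : ∀ s ∈ S, G.IsNormal s)
    (d : ℕ) : {s | s ∈ S ∧ G.deg s = d}.Finite := by
  refine ((finite_deg_eq G d).image Subtype.val).subset ?_
  rintro s ⟨hs, hd⟩
  exact ⟨⟨s, hS s hs⟩, hd, rfl⟩

theorem genFun_empty : G.genFun ∅ = 0 := by
  ext d
  simp [genFun]

theorem genFun_nil : G.genFun {[]} = 1 := by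
  ext d
  rw [genFun, coeff_mk, coeff_one]
  split_ifs with h
  · subst h
    have : {s : List (V × ℕ) | s ∈ ({[]} : Set (List (V × ℕ))) ∧ G.deg s = 0} = {[]} := by
      ext s
      simp only [Set.mem_singleton_iff, Set.mem_ofPred_eq, and_iff_left_iff_imp]
      rintro rfl
      rfl
    rw [this, Set.ncard_singleton, Nat.cast_one]
  · have : {s : List (V × ℕ) | s ∈ ({[]} : Set (List (V × ℕ))) ∧ G.deg s = d} = ∅ := by
      ext s
      simp only [Set.mem_singleton_iff, Set.mem_ofPred_eq, Set.mem_empty_iff_false, iff_false]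
      rintro ⟨rfl, hd⟩
      exact h hd.symm
    rw [this, Set.ncard_empty, Nat.cast_zero]

theorem genFun_union [Finite V] {S T : Set (List (V × ℕ))} (hS : ∀ s ∈ S, G.IsNormal s)
    (hT : ∀ s ∈ T, G.IsNormal s) (hST : Disjoint S T) :
    G.genFun (S ∪ T) = G.genFun S + G.genFun T := by
  ext d
  rw [map_add, genFun, genFun, genFun, coeff_mk, coeff_mk, coeff_mk, ← Nat.cast_add,
    ← Set.ncard_union_eq _ (finite_deg_fiber hS d) (finite_deg_fiber hT d)]
  · congr 2
    ext s
    simp [or_and_right]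
  · exact hST.mono (fun _ h => h.1) (fun _ h => h.1)

theorem genFun_biUnion [Finite V] {ι : Type*} (I : Finset ι) {S : ι → Set (List (V × ℕ))}
    (hS : ∀ i ∈ I, ∀ s ∈ S i, G.IsNormal s)
    (hd : ∀ i ∈ I, ∀ j ∈ I, i ≠ j → Disjoint (S i) (S j)) :
    G.genFun (⋃ i ∈ I, S i) = ∑ i ∈ I, G.genFun (S i) := by
  classical
  induction I using Finset.induction_on with
  | empty => simp [genFun_empty]
  | insert i I hi ih =>
    rw [Finset.set_biUnion_insert, Finset.sum_insert hi, genFun_union, ih]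
    · exact fun j hj => hS j (Finset.mem_insert_of_mem hj)
    · exact fun j hj l hl => hd j (Finset.mem_insert_of_mem hj) l (Finset.mem_insert_of_mem hl)
    · exact hS i (Finset.mem_insert_self i I)
    · intro s hs
      obtain ⟨j, hj, hs⟩ := Set.mem_iUnion₂.1 hs
      exact hS j (Finset.mem_insert_of_mem hj) s hs
    · rw [Set.disjoint_iUnion₂_right]
      intro j hj
      exact hd i (Finset.mem_insert_self i I) j (Finset.mem_insert_of_mem hj)
        (by rintro rfl; exact hi hj)

theorem genFun_diff [Finite V] {S T : Set (List (V × ℕ))} (hS : ∀ s ∈ S, G.IsNormal s)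
    (hT : T ⊆ S) : G.genFun (S \ T) = G.genFun S - G.genFun T := by
  rw [eq_sub_iff_add_eq, ← genFun_union (fun s hs => hS s hs.1) (fun s hs => hS s (hT hs))
    Set.disjoint_sdiff_left, Set.sdiff_union_of_subset hT]

theorem genFun_cons (x : V × ℕ) (S : Set (List (V × ℕ))) :
    G.genFun (List.cons x '' S) = X ^ x.2 * G.genFun S := by
  ext d
  rw [coeff_X_pow_mul', genFun, genFun, coeff_mk]
  have hdeg : ∀ s, G.deg (x :: s) = x.2 + G.deg s := fun s => by simp [deg]
  split_ifs with h
  · rw [coeff_mk, ← Set.ncard_image_of_injective {s | s ∈ S ∧ G.deg s = d - x.2}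
      (List.cons_injective (a := x))]
    congr 2
    ext s
    constructor
    · rintro ⟨⟨s, hs, rfl⟩, hd⟩
      rw [hdeg] at hd
      exact ⟨s, ⟨hs, by omega⟩, rfl⟩
    · rintro ⟨s, ⟨hs, hd⟩, rfl⟩
      exact ⟨⟨s, hs, rfl⟩, by rw [hdeg]; omega⟩
  · have : {s | s ∈ List.cons x '' S ∧ G.deg s = d} = ∅ := by
      ext s
      simp only [Set.mem_ofPred_eq, Set.mem_empty_iff_false, iff_false]
      rintro ⟨⟨s, hs, rfl⟩, hd⟩
      rw [hdeg] at hd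
      omega
    rw [this, Set.ncard_empty, Nat.cast_zero]

variable (σ : G.Aut)

/-- The normal words in letters fixed by `σ`. -/
def Aut.fixedWords : Set (List (V × ℕ)) := {s | G.IsNormal s ∧ ∀ x ∈ s, σ.onV x.1 = x.1}

/-- The normal words in letters fixed by `σ` that start with a letter `(v, j)`. -/
def Aut.fixedWordsFrom (v : V) : Set (List (V × ℕ)) :=
  {s | s ∈ σ.fixedWords ∧ ∃ j t, s = (v, j) :: t}

theorem fixedWordsFrom_disjoint {u v : V} (h : u ≠ v) :
    Disjoint (σ.fixedWordsFrom u) (σ.fixedWordsFrom v) := by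
  rw [Set.disjoint_left]
  rintro _ ⟨-, j, t, rfl⟩ ⟨-, j', t', e⟩
  simp only [List.cons.injEq, Prod.mk.injEq] at e
  exact h e.1.1

theorem fixedWordsFrom_star : σ.fixedWordsFrom G.star = ∅ := by
  ext s
  simp only [Set.mem_empty_iff_false, iff_false]
  rintro ⟨hs, j, t, rfl⟩
  have := hs.1.1 (G.star, j) List.mem_cons_self
  exact ne_star_of_level this.1 this.2 rfl

theorem fixedWordsFrom_of_not_fixed {v : V} (hv : σ.onV v ≠ v) : σ.fixedWordsFrom v = ∅ := by
  ext s
  simp only [Set.mem_empty_iff_false, iff_false]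
  rintro ⟨hs, j, t, rfl⟩
  exact hv (hs.2 (v, j) List.mem_cons_self)

theorem genFun_fixedWords [Fintype V] :
    G.genFun σ.fixedWords = 1 + ∑ v, G.genFun (σ.fixedWordsFrom v) := by
  rw [← genFun_biUnion Finset.univ (fun v _ s hs => hs.1.1)
    (fun u _ v _ h => fixedWordsFrom_disjoint σ h), ← genFun_nil (G := G), ← genFun_union]
  · congr 1
    ext s
    simp only [Finset.mem_univ, Set.iUnion_true, Set.singleton_union, Set.mem_insert_iff,
      Set.mem_iUnion]
    constructor
    · intro hs
      cases s with
      | nil => exact Or.inl rfl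
      | cons x s => exact Or.inr ⟨x.1, hs, x.2, s, rfl⟩
    · rintro (rfl | ⟨v, hs, -⟩)
      · exact ⟨⟨by simp [IsLetterWord], .nil⟩, by simp⟩
      · exact hs
  · rintro _ rfl
    exact ⟨by simp [IsLetterWord], .nil⟩
  · intro s hs
    obtain ⟨v, -, hs⟩ := Set.mem_iUnion₂.1 hs
    exact hs.1.1
  · rw [Set.disjoint_singleton_left]
    intro hs
    obtain ⟨v, -, -, j, t, e⟩ := Set.mem_iUnion₂.1 hs
    exact List.cons_ne_nil _ _ e.symm

-- After the first letter (v, j) any fixed normal word may follow, except those starting at some u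
-- below v with |u| = |v| - j.
open Classical in
theorem genFun_fixedWordsFrom [Fintype V] {v : V} (hv : σ.onV v = v) :
    G.genFun (σ.fixedWordsFrom v) = ∑ j ∈ Finset.Icc 1 (G.level v), X ^ j *
      (G.genFun σ.fixedWords - ∑ u with G.Gt v u ∧ j + G.level u = G.level v,
        G.genFun (σ.fixedWordsFrom u)) := by
  have hF : ∀ s ∈ σ.fixedWords, G.IsNormal s := fun s hs => hs.1
  have e : ∀ j ∈ Finset.Icc 1 (G.level v), X ^ j *
      (G.genFun σ.fixedWords - ∑ u with G.Gt v u ∧ j + G.level u = G.level v,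
        G.genFun (σ.fixedWordsFrom u)) = G.genFun (List.cons (v, j) '' (σ.fixedWords \
          ⋃ u ∈ Finset.univ.filter fun u => G.Gt v u ∧ j + G.level u = G.level v,
            σ.fixedWordsFrom u)) := by
    intro j _
    rw [genFun_cons, genFun_diff hF, genFun_biUnion]
    · exact fun u _ s hs => hs.1.1
    · exact fun u _ v _ h => fixedWordsFrom_disjoint σ h
    · intro s hs
      obtain ⟨u, -, hs⟩ := Set.mem_iUnion₂.1 hs
      exact hs.1
  have key : ∀ j ∈ Finset.Icc 1 (G.level v), ∀ t, (v, j) :: t ∈ σ.fixedWords ↔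
      t ∈ σ.fixedWords \
          ⋃ u ∈ Finset.univ.filter fun u => G.Gt v u ∧ j + G.level u = G.level v,
            σ.fixedWordsFrom u := by
    intro j hj t
    rw [Finset.mem_Icc] at hj
    simp only [Set.mem_sdiff, Set.mem_iUnion, Finset.mem_filter, Finset.mem_univ, true_and,
      not_exists]
    constructor
    · rintro ⟨h1, h2⟩
      have ht : t ∈ σ.fixedWords := ⟨h1.tail, fun x hx => h2 x (List.mem_cons_of_mem _ hx)⟩
      refine ⟨ht, ?_⟩
      rintro u hu ⟨-, m, t', rfl⟩
      exact (List.isChain_cons_cons.1 h1.2).1 hu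
    · rintro ⟨ht, h⟩
      refine ⟨⟨?_, ?_⟩, ?_⟩
      · intro x hx
        rcases List.mem_cons.1 hx with rfl | hx
        · exact hj
        · exact ht.1.1 x hx
      · cases t with
        | nil => exact .singleton _
        | cons y t =>
          refine List.isChain_cons_cons.2 ⟨fun hc => ?_, ht.1.2⟩
          exact h y.1 hc ⟨ht, y.2, t, rfl⟩
      · intro x hx
        rcases List.mem_cons.1 hx with rfl | hx
        · exact hv
        · exact ht.2 x hx
  rw [Finset.sum_congr rfl e, ← genFun_biUnion]
  · congr 1
    ext s
    simp only [Set.mem_iUnion]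
    constructor
    · rintro ⟨hs, j, t, rfl⟩
      have hj := Finset.mem_Icc.2 (hs.1.1 (v, j) List.mem_cons_self)
      exact ⟨j, hj, t, (key j hj t).1 hs, rfl⟩
    · rintro ⟨j, hj, t, ht, rfl⟩
      exact ⟨(key j hj t).2 ht, j, t, rfl⟩
  · rintro j hj _ ⟨t, ht, rfl⟩
    exact ((key j hj t).2 ht).1
  · intro j _ j' _ hne
    rw [Set.disjoint_left]
    rintro _ ⟨t, -, rfl⟩ ⟨t', -, e⟩
    simp only [List.cons.injEq, Prod.mk.injEq, true_and] at e
    exact hne e.1.symm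

/-- The contribution of a chain of vertices to the chain polynomial. -/
noncomputable def chainTerm (G : LayeredGraph V E) (c : List V) : Polynomial ℤ :=
  (-1) ^ (c.length - 1) * Polynomial.X ^ ((c.head?.map G.level).getD 0 -
    (c.getLast?.map G.level).getD 0)

/-- The chains of vertices fixed by `σ` starting at `v`. -/
def Aut.chainsFrom (v : V) : Set (List V) :=
  {c | c.head? = some v ∧ (∀ v ∈ c, σ.onV v = v) ∧ c.IsChain G.Gt}

/-- The chain polynomial of the chains starting at `v`. -/
noncomputable def Aut.chainSumFrom (v : V) : Polynomial ℤ :=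
  ∑ᶠ c ∈ σ.chainsFrom v, G.chainTerm c

theorem finite_chainsFrom [Finite V] (v : V) : (σ.chainsFrom v).Finite := by
  refine (Set.finite_range fun c : σ.FixedChain => c.1).subset ?_
  rintro c ⟨hc, h1, h2⟩
  exact ⟨⟨c, by rintro rfl; simp at hc, h1, h2⟩, rfl⟩

theorem chainsFrom_disjoint : Pairwise (Function.onFun Disjoint σ.chainsFrom) := by
  intro u v huv
  refine Set.disjoint_left.2 fun c hu hv => huv ?_
  exact Option.some.inj (hu.1.symm.trans hv.1)

theorem chainSum_eq [Fintype V] : σ.chainSum = ∑ v, σ.chainSumFrom v := by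
  have e : ∀ c : σ.FixedChain, (-1) ^ (c.1.length - 1) *
      Polynomial.X ^ (G.level (c.1.head c.2.1) - G.level (c.1.getLast c.2.1)) =
      G.chainTerm c.1 := by
    intro c
    rw [chainTerm, List.head?_eq_some_head c.2.1, List.getLast?_eq_some_getLast c.2.1]
    rfl
  have h : {c : List V | c ≠ [] ∧ (∀ v ∈ c, σ.onV v = v) ∧ c.IsChain G.Gt} =
      ⋃ v, σ.chainsFrom v := by
    ext c
    simp only [Set.mem_iUnion]
    constructor
    · rintro ⟨h0, h⟩
      exact ⟨c.head h0, List.head?_eq_some_head h0, h⟩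
    · rintro ⟨v, hv, h⟩
      exact ⟨by rintro rfl; simp at hv, h⟩
  rw [Aut.chainSum, Finset.sum_congr rfl fun c _ => e c, ← finsum_eq_sum_of_fintype,
    ← finsum_eq_sum_of_fintype]
  refine (finsum_set_coe_eq_finsum_mem (f := G.chainTerm)
    {c : List V | c ≠ [] ∧ (∀ v ∈ c, σ.onV v = v) ∧ c.IsChain G.Gt}).trans ?_
  rw [h, finsum_mem_iUnion (chainsFrom_disjoint σ) (finite_chainsFrom σ)]
  rfl

theorem chainSumFrom_of_not_fixed {v : V} (hv : σ.onV v ≠ v) : σ.chainSumFrom v = 0 := by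
  have : σ.chainsFrom v = ∅ := by
    ext c
    simp only [Set.mem_empty_iff_false, iff_false]
    rintro ⟨h1, h2, -⟩
    exact hv (h2 v (List.mem_of_mem_head? h1))
  rw [Aut.chainSumFrom, this, finsum_mem_empty]

theorem chainTerm_cons {u v : V} (huv : G.Gt v u) {c : List V} (hc : c ∈ σ.chainsFrom u) :
    G.chainTerm (v :: c) = -(Polynomial.X ^ (G.level v - G.level u) * G.chainTerm c) := by
  obtain ⟨hu, -, hc⟩ := hc
  obtain - | ⟨x, c⟩ := c
  · simp at hu
  obtain rfl : x = u := by simpa using hu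
  -- The exponents are truncated differences of natural numbers, so splitting the exponent requires
  -- the last level not to exceed the first.
  have hlast : G.level ((x :: c).getLast (List.cons_ne_nil x c)) ≤ G.level x := by
    have : IsTrans V fun v w => G.level w ≤ G.level v := ⟨fun _ _ _ h h' => h'.trans h⟩
    have hp := List.isChain_iff_pairwise.1
      (hc.imp (S := fun v w => G.level w ≤ G.level v) fun _ _ h => (Gt.level_lt h).le)
    rcases List.mem_cons.1 (List.getLast_mem (List.cons_ne_nil x c)) with h | h
    · rw [h]
    · exact (List.pairwise_cons.1 hp).1 _ h
  have hlt := Gt.level_lt huv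
  rw [chainTerm, chainTerm, List.getLast?_cons_cons,
    List.getLast?_eq_some_getLast (List.cons_ne_nil x c)]
  simp only [List.head?_cons, Option.map_some, Option.getD_some, List.length_cons,
    Nat.add_sub_cancel]
  rw [show G.level v - G.level ((x :: c).getLast (List.cons_ne_nil x c)) =
    (G.level v - G.level x) + (G.level x - G.level ((x :: c).getLast (List.cons_ne_nil x c))) by
      omega, pow_succ, pow_add]
  ring

-- A chain from v is v alone or v followed by a chain from some u below v; the extra vertex changes
-- the sign and adds |v| - |u| to the exponent.
open Classical in
theorem chainSumFrom_eq [Fintype V] {v : V} (hv : σ.onV v = v) :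
    σ.chainSumFrom v =
      1 - ∑ u with G.Gt v u, Polynomial.X ^ (G.level v - G.level u) * σ.chainSumFrom u := by
  have h : σ.chainsFrom v = insert [v]
      (List.cons v '' ⋃ u ∈ Finset.univ.filter (G.Gt v), σ.chainsFrom u) := by
    ext c
    simp only [Set.mem_insert_iff, Set.mem_image, Set.mem_iUnion, Finset.mem_filter,
      Finset.mem_univ, true_and]
    constructor
    · rintro ⟨h1, h2, h3⟩
      obtain - | ⟨x, c⟩ := c
      · simp at h1
      obtain rfl : x = v := by simpa using h1
      obtain - | ⟨u, c⟩ := c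
      · exact Or.inl rfl
      · have h4 := List.isChain_cons_cons.1 h3
        exact Or.inr ⟨u :: c, ⟨u, h4.1, rfl, fun w hw => h2 w (List.mem_cons_of_mem _ hw), h4.2⟩,
          rfl⟩
    · rintro (rfl | ⟨c, ⟨u, hu, h1, h2, h3⟩, rfl⟩)
      · exact ⟨rfl, by simpa using hv, .singleton _⟩
      · obtain - | ⟨x, c⟩ := c
        · simp at h1
        obtain rfl : x = u := by simpa using h1
        refine ⟨rfl, fun w hw => ?_, List.isChain_cons_cons.2 ⟨hu, h3⟩⟩
        rcases List.mem_cons.1 hw with rfl | hw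
        · exact hv
        · exact h2 w hw
  have hfin : (⋃ u ∈ Finset.univ.filter (G.Gt v), σ.chainsFrom u).Finite :=
    (Finset.finite_toSet _).biUnion fun u _ => finite_chainsFrom σ u
  rw [Aut.chainSumFrom, h, finsum_mem_insert, finsum_mem_image List.cons_injective.injOn]
  · have h1 : G.chainTerm [v] = 1 := by simp [chainTerm]
    rw [h1, sub_eq_add_neg, ← Finset.sum_neg_distrib]
    congr 1
    have h2 := finsum_mem_biUnion (f := fun c => G.chainTerm (v :: c))
      (I := ((Finset.univ.filter (G.Gt v) : Finset V) : Set V)) (t := σ.chainsFrom)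
      (fun _ _ _ _ h => chainsFrom_disjoint σ h) (Finset.finite_toSet _)
      (fun u _ => finite_chainsFrom σ u)
    rw [finsum_mem_coe_finset] at h2
    refine h2.trans (Finset.sum_congr rfl fun u hu => ?_)
    rw [Aut.chainSumFrom, ← smul_eq_mul, ← smul_neg, smul_eq_mul, ← neg_mul_comm,
      mul_finsum_mem]
    refine finsum_mem_congr rfl fun c hc => ?_
    rw [chainTerm_cons σ (Finset.mem_filter.1 hu).2 hc, neg_mul]
  · rintro ⟨c, hc, e⟩
    obtain ⟨u, -, hc⟩ := Set.mem_iUnion₂.1 hc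
    obtain rfl : c = [] := by simpa using e
    simpa using hc.1
  · exact hfin.image _

end GeneratingFunction

end LayeredGraph

namespace LayeredGraph

/-! ### The Hilbert series -/

section HilbertSeries

open PowerSeries

variable {V E : Type*} {G : LayeredGraph V E} (σ : G.Aut)

theorem chainSumFrom_star [Fintype V] : σ.chainSumFrom G.star = 1 := by
  classical
  rw [chainSumFrom_eq σ σ.onV_star, Finset.filter_false_of_mem, Finset.sum_empty, sub_zero]
  intro u _ hu
  have := Gt.level_lt hu
  rw [(G.level_eq_zero_iff G.star).2 rfl] at this
  exact Nat.not_lt_zero _ this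

theorem one_sub_X_mul_sum_X_pow (n : ℕ) :
    (1 - X : PowerSeries ℤ) * ∑ j ∈ Finset.Icc 1 n, X ^ j = X * (1 - X ^ n) := by
  induction n with
  | zero => simp
  | succ n ih =>
    rw [Finset.sum_Icc_succ_top (by omega), mul_add, ih]
    ring

-- Induction on the level, comparing `genFun_fixedWordsFrom` with `chainSumFrom_eq`. The correction
-- at * is needed because no normal word starts at * although there is the chain consisting of *
-- alone.
open Classical in
theorem one_sub_X_mul_genFun [Fintype V] (v : V) :
    (1 - X) * G.genFun (σ.fixedWordsFrom v) = X * G.genFun σ.fixedWords *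
      ((σ.chainSumFrom v : PowerSeries ℤ) - if v = G.star then 1 else 0) := by
  induction hl : G.level v using Nat.strong_induction_on generalizing v with
  | _ l ih =>
  subst hl
  by_cases hv : v = G.star
  · subst hv
    rw [fixedWordsFrom_star, genFun_empty, chainSumFrom_star, if_pos rfl]
    simp
  by_cases hσ : σ.onV v = v
  swap
  · rw [fixedWordsFrom_of_not_fixed σ hσ, genFun_empty, chainSumFrom_of_not_fixed σ hσ, if_neg hv]
    simp
  -- After exchanging the sums, each u below v is met for exactly one index, j = |v| - |u|.
  have h1 : ∑ j ∈ Finset.Icc 1 (G.level v), (X : PowerSeries ℤ) ^ j *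
      ∑ u with G.Gt v u ∧ j + G.level u = G.level v, G.genFun (σ.fixedWordsFrom u) =
      ∑ u with G.Gt v u, X ^ (G.level v - G.level u) * G.genFun (σ.fixedWordsFrom u) := by
    simp_rw [Finset.mul_sum, ← Finset.filter_filter]
    simp_rw [Finset.sum_filter (fun u => _ + G.level u = G.level v)]
    rw [Finset.sum_comm]
    refine Finset.sum_congr rfl fun u hu => ?_
    have hlt := Gt.level_lt (Finset.mem_filter.1 hu).2
    rw [Finset.sum_eq_single (G.level v - G.level u)]
    · rw [if_pos (Nat.sub_add_cancel hlt.le)]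
    · intro j _ hj
      rw [if_neg (by omega)]
    · intro h
      rw [Finset.mem_Icc] at h
      omega
  have h2 : (1 - X) * ∑ u with G.Gt v u,
      X ^ (G.level v - G.level u) * G.genFun (σ.fixedWordsFrom u) =
      X * G.genFun σ.fixedWords * (∑ u with G.Gt v u, X ^ (G.level v - G.level u) *
        (σ.chainSumFrom u : PowerSeries ℤ) - X ^ G.level v) := by
    -- Every v ≠ * lies above *, so the correction contributes t^|v| exactly once; this cancels the
    -- -t^|v| of the geometric sum over j.
    have h3 : ∑ u with G.Gt v u, (X : PowerSeries ℤ) ^ (G.level v - G.level u) *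
        (if u = G.star then 1 else 0) = X ^ G.level v := by
      rw [Finset.sum_eq_single G.star]
      · rw [if_pos rfl, mul_one, (G.level_eq_zero_iff G.star).2 rfl, Nat.sub_zero]
      · intro u _ hu
        rw [if_neg hu, mul_zero]
      · intro h
        exact (h (Finset.mem_filter.2 ⟨Finset.mem_univ _, gt_star v hv⟩)).elim
    rw [← h3, ← Finset.sum_sub_distrib, Finset.mul_sum, Finset.mul_sum]
    refine Finset.sum_congr rfl fun u hu => ?_
    rw [mul_left_comm, ih _ (Gt.level_lt (Finset.mem_filter.1 hu).2) u rfl]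
    ring
  have h4 : (σ.chainSumFrom v : PowerSeries ℤ) = 1 - ∑ u with G.Gt v u,
      X ^ (G.level v - G.level u) * (σ.chainSumFrom u : PowerSeries ℤ) := by
    have := congrArg Polynomial.coeToPowerSeries.ringHom (chainSumFrom_eq σ hσ)
    rw [map_sub, map_sum] at this
    simpa using this
  rw [genFun_fixedWordsFrom σ hσ]
  simp_rw [mul_sub (X ^ _)]
  rw [Finset.sum_sub_distrib, h1, mul_sub, h2, h4, ← Finset.sum_mul, ← mul_assoc,
    one_sub_X_mul_sum_X_pow, if_neg hv]
  ring

theorem genFun_fixedWords_mul [Finite V] :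
    G.genFun σ.fixedWords * (1 - X * (σ.chainSum : PowerSeries ℤ)) = 1 - X := by
  classical
  have := Fintype.ofFinite V
  have h1 : (σ.chainSum : PowerSeries ℤ) = ∑ v, (σ.chainSumFrom v : PowerSeries ℤ) := by
    have := congrArg Polynomial.coeToPowerSeries.ringHom (chainSum_eq σ)
    simpa [map_sum] using this
  have h2 : (1 - X) * ∑ v, G.genFun (σ.fixedWordsFrom v) =
      X * G.genFun σ.fixedWords * ((σ.chainSum : PowerSeries ℤ) - 1) := by
    rw [Finset.mul_sum, Finset.sum_congr rfl fun v _ => one_sub_X_mul_genFun σ v,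
      ← Finset.mul_sum, Finset.sum_sub_distrib, h1]
    simp
  have h3 := genFun_fixedWords σ
  linear_combination (1 - X) * h3 + h2

theorem fixedHilbertSeries_eq_genFun [Finite V] (D : G.DistinguishedEdges) (k : Type*) [Field k] :
    σ.fixedHilbertSeries k D = G.genFun σ.fixedWords := by
  ext d
  rw [coeff_fixedHilbertSeries, genFun, coeff_mk, Aut.fixedCount]
  simp only [Aut.fixedWords, Set.mem_ofPred_eq, and_assoc]

theorem isUnit_one_sub_X_mul (f : PowerSeries ℤ) : IsUnit (1 - X * f) := by
  rw [isUnit_iff_constantCoeff]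
  simp

end HilbertSeries

end LayeredGraph

theorem theoremT {V E k : Type*} [Finite V] [Field k] (G : LayeredGraph V E)
    (D : G.DistinguishedEdges) (σ : G.Aut) :
    (∃ S : Subalgebra k (G.GrAlg k), Subalgebra.toSubmodule S = σ.fixedPart k D) ∧
    (∀ d, Module.Finite k (G.degreePart k d)) ∧
    (∀ d, Module.Finite k (G.grDegreePart k d)) ∧
    σ.gradedTraceGr k = PowerSeries.map (Int.castRingHom k) (σ.fixedHilbertSeries k D) ∧
    σ.gradedTraceAlg k = PowerSeries.map (Int.castRingHom k) (σ.fixedHilbertSeries k D) ∧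
    IsUnit (1 - PowerSeries.X * (σ.chainSum : PowerSeries ℤ)) ∧
    σ.fixedHilbertSeries k D * (1 - PowerSeries.X * (σ.chainSum : PowerSeries ℤ)) =
      1 - PowerSeries.X := by
  refine ⟨⟨(σ.fixedPart k D).toSubalgebra (LayeredGraph.one_mem_fixedPart σ D k)
    (fun _ _ => LayeredGraph.mul_mem_fixedPart σ D k), Submodule.toSubalgebra_toSubmodule _ _ _⟩,
    LayeredGraph.finite_degreePart k D, LayeredGraph.finite_grDegreePart k D,
    LayeredGraph.gradedTraceGr_eq σ D k, LayeredGraph.gradedTraceAlg_eq σ D k,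
    LayeredGraph.isUnit_one_sub_X_mul _, ?_⟩
  rw [LayeredGraph.fixedHilbertSeries_eq_genFun σ D k]
  exact LayeredGraph.genFun_fixedWords_mul σ
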